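/- **Lemma 5.7.** Let $\alpha,\beta,\mu\in\mathbb R\setminus\{0\}$ be such that $\Delta:=\alpha^2+\beta^2-2\mu^2>0$, and for $t,x,x_1,x_2\in\mathbb R$ put $$y_1=x+(\alpha^2-3\beta^2)t+x_1,\qquad y_2=x+(3\alpha^2-\beta^2)t+x_2,$$ $$G_\mu=\frac{\beta\sqrt{\alpha^2+\beta^2}}{\alpha\sqrt\Delta}\sin(\alpha y_1)-\frac{\sqrt2\,\mu\beta\,[\cosh(\beta y_2)+\sinh(\beta y_2)]}{\Delta},$$ $$F_\mu=\cosh(\beta y_2)-\frac{\sqrt2\,\mu\beta\,[\alpha\cos(\alpha y_1)-\beta\sin(\alpha y_1)]}{\alpha\sqrt{\alpha^2+\beta^2}\sqrt\Delta},\qquad D_\mu=F_\mu^2+G_\mu^2 .$$ Let $\tilde B_\mu=2\sqrt2\arctan(G_\mu/F_\mu)$, where $\arctan(G_\mu/F_\mu)$ denotes the smooth branch given by the principal argument of $F_\mu+iG_\mu$ (which never lies on $(-\infty,0]$), let $B_\mu=\partial_x\tilde B_\mu$ be the Gardner breather, and let $B_1=\partial_{x_1}B_\mu$, $B_2=\partial_{x_2}B_\mu$,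 $\tilde B_{11}=\partial_{x_1}^2\tilde B_\mu$ and $$W[B_1,B_2]=\begin{pmatrix}B_1&B_2\\ \partial_xB_1&\partial_xB_2\end{pmatrix}.$$ Then, with $K:=(\alpha^2+\beta^2)^2-4\mu^2(\alpha^2-\mu^2)$ (which is positive), for all $t,x,x_1,x_2\in\mathbb R$, $$\det W[B_1,B_2]=-\frac{4\beta^3(\alpha^2+\beta^2)^2K}{\Delta^3D_\mu^2}\Big[\sinh(2\beta y_2)+\frac{4\beta^2\mu^2\cosh(2\beta y_2)}{K}-\frac{\beta\Delta\big((\alpha^2+\beta^2)^2-2\mu^2(\alpha^2-\beta^2)\big)\sin(2\alpha y_1)}{\alpha(\alpha^2+\beta^2)K}+\frac{4\beta^2\mu^2\Delta\cos(2\alpha y_1)}{(\alpha^2+\beta^2)K}\Big],$$ and moreover $$\det W[B_1,B_2]=2(\alpha^2+\beta^2)\Big[-(\mu+B_\mu)\tilde B_{11}+\partial_{x_1}^2\partial_x\log\big(F_\mu^2+G_\mu^2\big)\Big].$$ -/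

import Mathlib

namespace Gardner

noncomputable section

/-! A scalar field is written as `f t x x₁ x₂`, where `t` is time, `x` is space and `x₁`, `x₂` are
the two shift parameters. -/

/-- The partial derivative with respect to `x`. -/
def dx (f : ℝ → ℝ → ℝ → ℝ → ℝ) : ℝ → ℝ → ℝ → ℝ → ℝ :=
  fun t x x₁ x₂ => deriv (fun s => f t s x₁ x₂) x

/-- The partial derivative with respect to the first shift `x₁`. -/
def d₁ (f : ℝ → ℝ → ℝ → ℝ → ℝ) : ℝ → ℝ → ℝ → ℝ → ℝ :=
  fun t x x₁ x₂ => deriv (fun s => f t x s x₂) x₁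

/-- The partial derivative with respect to the second shift `x₂`. -/
def d₂ (f : ℝ → ℝ → ℝ → ℝ → ℝ) : ℝ → ℝ → ℝ → ℝ → ℝ :=
  fun t x x₁ x₂ => deriv (fun s => f t x x₁ s) x₂

/-- `Δ = α² + β² - 2μ²`. -/
def Delta (α β μ : ℝ) : ℝ := α ^ 2 + β ^ 2 - 2 * μ ^ 2

/-- `y₁ = x + δ t + x₁` with `δ = α² - 3β²`. -/
def y₁ (α β t x x₁ : ℝ) : ℝ := x + (α ^ 2 - 3 * β ^ 2) * t + x₁

/-- `y₂ = x + γ t + x₂` with `γ = 3α² - β²`. -/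
def y₂ (α β t x x₂ : ℝ) : ℝ := x + (3 * α ^ 2 - β ^ 2) * t + x₂

/-- The function `G_μ`. -/
def G (α β μ t x x₁ x₂ : ℝ) : ℝ :=
  β * √(α ^ 2 + β ^ 2) / (α * √(Delta α β μ)) * Real.sin (α * y₁ α β t x x₁)
    - √2 * μ * β * (Real.cosh (β * y₂ α β t x x₂) + Real.sinh (β * y₂ α β t x x₂))
      / Delta α β μ

/-- The function `F_μ`. -/
def F (α β μ t x x₁ x₂ : ℝ) : ℝ :=
  Real.cosh (β * y₂ α β t x x₂)
    - √2 * μ * β * (α * Real.cos (α * y₁ α β t x x₁) - β * Real.sin (α * y₁ α β t x x₁))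
      / (α * √(α ^ 2 + β ^ 2) * √(Delta α β μ))

/-- `D_μ = F_μ² + G_μ²`. -/
def D (α β μ t x x₁ x₂ : ℝ) : ℝ := F α β μ t x x₁ x₂ ^ 2 + G α β μ t x x₁ x₂ ^ 2

/-- The potential `B̃_μ = 2√2 arctan (G_μ / F_μ)`. The function `F_μ` may vanish, and `arctan (G/F)`
stands for its smooth branch, which is the argument of `F + iG`: see `arg_eq_arctan_of_pos` for
the agreement with `arctan (G/F)` where `F > 0`, `contDiff_Btilde` for the smoothness, and
`breather_eq_arctan` for the agreement of the `x`-derivatives wherever `F ≠ 0`. -/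
def Btilde (α β μ t x x₁ x₂ : ℝ) : ℝ :=
  2 * √2 * Complex.arg ⟨F α β μ t x x₁ x₂, G α β μ t x x₁ x₂⟩

/-- The Gardner breather `B_μ = ∂ₓ B̃_μ`. -/
def breather (α β μ : ℝ) : ℝ → ℝ → ℝ → ℝ → ℝ := dx (Btilde α β μ)

/-- The kernel element `B₁ = ∂_{x₁} B_μ`. -/
def B₁ (α β μ : ℝ) : ℝ → ℝ → ℝ → ℝ → ℝ := d₁ (breather α β μ)

/-- The kernel element `B₂ = ∂_{x₂} B_μ`. -/
def B₂ (α β μ : ℝ) : ℝ → ℝ → ℝ → ℝ → ℝ := d₂ (breather α β μ)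

/-- The Wronskian matrix (in the variable `x`) of two fields, at `(t, x, x₁, x₂)`. -/
def wronskian (f g : ℝ → ℝ → ℝ → ℝ → ℝ) (t x x₁ x₂ : ℝ) : Matrix (Fin 2) (Fin 2) ℝ :=
  !![f t x x₁ x₂, g t x x₁ x₂; dx f t x x₁ x₂, dx g t x x₁ x₂]

/-- The positive constant `(α² + β²)² - 4μ²(α² - μ²)`. -/
def K (α β μ : ℝ) : ℝ := (α ^ 2 + β ^ 2) ^ 2 - 4 * μ ^ 2 * (α ^ 2 - μ ^ 2)

/-! ### The definitions make sense: there is no division by zero and the branch is smooth. -/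

theorem K_pos {α β μ : ℝ} (h : 0 < Delta α β μ) : 0 < K α β μ := by
  have : K α β μ = Delta α β μ ^ 2 + 4 * μ ^ 2 * β ^ 2 := by unfold K Delta; ring
  rw [this]; positivity

/-- `F + iG` never meets the closed negative real axis. -/
theorem mem_slitPlane {α β μ : ℝ} (hα : α ≠ 0) (hβ : β ≠ 0) (h : 0 < Delta α β μ)
    (t x x₁ x₂ : ℝ) :
    (⟨F α β μ t x x₁ x₂, G α β μ t x x₁ x₂⟩ : ℂ) ∈ Complex.slitPlane := by
  rw [Complex.mem_slitPlane_iff]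
  by_cases hG : G α β μ t x x₁ x₂ = 0
  swap
  · exact Or.inr hG
  left
  change 0 < F α β μ t x x₁ x₂
  unfold G at hG
  unfold F
  rw [Real.cosh_add_sinh] at hG
  set S := Real.sin (α * y₁ α β t x x₁)
  set C := Real.cos (α * y₁ α β t x x₁)
  have hSC : S ^ 2 + C ^ 2 = 1 := Real.sin_sq_add_cos_sq _
  rw [Real.cosh_eq, Real.exp_neg]
  set e := Real.exp (β * y₂ α β t x x₂)
  have he : 0 < e := Real.exp_pos _
  set r := √(Delta α β μ) with hr
  have hrp : 0 < r := Real.sqrt_pos.2 h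
  have hr2 : Delta α β μ = r ^ 2 := (Real.sq_sqrt h.le).symm
  have hsp : 0 < √(α ^ 2 + β ^ 2) := Real.sqrt_pos.2 (by positivity)
  set s := √(α ^ 2 + β ^ 2)
  set w := √(2 : ℝ)
  rw [hr2] at hG
  have h1 : w * μ * e = s * r * S / α := by
    field_simp at hG ⊢
    rw [mul_zero] at hG
    linarith [(mul_eq_zero.1 hG).resolve_left hβ]
  have h2 : 2 * e * ((e + e⁻¹) / 2 - w * μ * β * (α * C - β * S) / (α * s * r))
      = e ^ 2 + (C - β * S / α) ^ 2 + S ^ 2 * (1 + β ^ 2 / α ^ 2) := by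
    have : 2 * e * ((e + e⁻¹) / 2 - w * μ * β * (α * C - β * S) / (α * s * r))
      = e ^ 2 + 1 - 2 * β * (α * C - β * S) / (α * s * r) * (w * μ * e) := by
      field_simp
    rw [this, h1]
    field_simp
    linear_combination (-(α ^ 2)) * hSC
  have h3 : 0 < 2 * e * ((e + e⁻¹) / 2 - w * μ * β * (α * C - β * S) / (α * s * r)) := by
    rw [h2]; positivity
  exact pos_of_mul_pos_right h3 (by positivity)

theorem D_pos {α β μ : ℝ} (hα : α ≠ 0) (hβ : β ≠ 0) (h : 0 < Delta α β μ)
    (t x x₁ x₂ : ℝ) : 0 < D α β μ t x x₁ x₂ := by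
  have h0 := Complex.slitPlane_ne_zero (mem_slitPlane hα hβ h t x x₁ x₂)
  have := Complex.normSq_pos.2 h0
  simpa [Complex.normSq_apply, D, sq] using this

/-- The potential is a smooth function of `(t, x, x₁, x₂)`. -/
theorem contDiff_Btilde {α β μ : ℝ} (hα : α ≠ 0) (hβ : β ≠ 0) (h : 0 < Delta α β μ) :
    ContDiff ℝ (⊤ : ℕ∞)
      (fun p : ℝ × ℝ × ℝ × ℝ => Btilde α β μ p.1 p.2.1 p.2.2.1 p.2.2.2) := by
  have hF : ContDiff ℝ (⊤ : ℕ∞)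
      (fun p : ℝ × ℝ × ℝ × ℝ => F α β μ p.1 p.2.1 p.2.2.1 p.2.2.2) := by
    unfold F y₁ y₂; fun_prop
  have hG : ContDiff ℝ (⊤ : ℕ∞)
      (fun p : ℝ × ℝ × ℝ × ℝ => G α β μ p.1 p.2.1 p.2.2.1 p.2.2.2) := by
    unfold G y₁ y₂; fun_prop
  have hz : ContDiff ℝ (⊤ : ℕ∞) (fun p : ℝ × ℝ × ℝ × ℝ =>
      (⟨F α β μ p.1 p.2.1 p.2.2.1 p.2.2.2, G α β μ p.1 p.2.1 p.2.2.1 p.2.2.2⟩ : ℂ)) :=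
    Complex.equivRealProdCLM.symm.contDiff.comp (hF.prodMk hG)
  have hl : ContDiff ℝ (⊤ : ℕ∞) (fun p : ℝ × ℝ × ℝ × ℝ => Complex.log
      (⟨F α β μ p.1 p.2.1 p.2.2.1 p.2.2.2, G α β μ p.1 p.2.1 p.2.2.1 p.2.2.2⟩ : ℂ)) := by
    rw [contDiff_iff_contDiffAt] at hz ⊢
    intro p
    exact ((Complex.contDiffAt_log (n := (⊤ : ℕ∞))
      (mem_slitPlane hα hβ h p.1 p.2.1 p.2.2.1 p.2.2.2)).restrict_scalars ℝ).comp p (hz p)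
  have ha : ContDiff ℝ (⊤ : ℕ∞) (fun p : ℝ × ℝ × ℝ × ℝ => Complex.arg
      (⟨F α β μ p.1 p.2.1 p.2.2.1 p.2.2.2, G α β μ p.1 p.2.1 p.2.2.1 p.2.2.2⟩ : ℂ)) := by
    simp only [← Complex.log_im]
    exact Complex.imCLM.contDiff.comp hl
  exact contDiff_const.mul ha

theorem arg_eq_arctan_of_pos {a b : ℝ} (ha : 0 < a) : Complex.arg ⟨a, b⟩ = Real.arctan (b / a) := by
  have h1 := Complex.abs_arg_lt_pi_div_two_iff.2
    (Or.inl ha : 0 < (⟨a, b⟩ : ℂ).re ∨ (⟨a, b⟩ : ℂ) = 0)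
  rw [abs_lt] at h1
  rw [← Real.arctan_tan h1.1 h1.2, Complex.tan_arg]

/-- Wherever `F ≠ 0`, the breather is `2√2 ∂ₓ arctan (G/F)`. -/
theorem breather_eq_arctan {α β μ : ℝ} (hα : α ≠ 0) (hβ : β ≠ 0) (h : 0 < Delta α β μ)
    (t x x₁ x₂ : ℝ) (hne : F α β μ t x x₁ x₂ ≠ 0) :
    breather α β μ t x x₁ x₂
      = 2 * √2 * deriv (fun s => Real.arctan (G α β μ t s x₁ x₂ / F α β μ t s x₁ x₂)) x := by
  have hc : Differentiable ℝ (fun s => F α β μ t s x₁ x₂) := by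
    unfold F y₁ y₂; fun_prop
  have hd : Differentiable ℝ (fun s => G α β μ t s x₁ x₂) := by
    unfold G y₁ y₂; fun_prop
  obtain ⟨F', hF'⟩ : ∃ F', HasDerivAt (fun s => F α β μ t s x₁ x₂) F' x :=
    ⟨_, (hc x).hasDerivAt⟩
  obtain ⟨G', hG'⟩ : ∃ G', HasDerivAt (fun s => G α β μ t s x₁ x₂) G' x :=
    ⟨_, (hd x).hasDerivAt⟩
  have hm := mem_slitPlane hα hβ h t x x₁ x₂
  have hz : HasDerivAt (fun s => (⟨F α β μ t s x₁ x₂, G α β μ t s x₁ x₂⟩ : ℂ))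
      (⟨F', G'⟩ : ℂ) x :=
    Complex.equivRealProdCLM.symm.hasFDerivAt.comp_hasDerivAt x (hF'.prodMk hG')
  have ha : HasDerivAt (fun s => Complex.arg ⟨F α β μ t s x₁ x₂, G α β μ t s x₁ x₂⟩)
      (Complex.imCLM ((⟨F', G'⟩ : ℂ) / ⟨F α β μ t x x₁ x₂, G α β μ t x x₁ x₂⟩)) x := by
    simp only [← Complex.log_im]
    exact Complex.imCLM.hasFDerivAt.comp_hasDerivAt x (hz.clog_real hm)
  have hq := (hG'.div hF' hne).arctan
  have hD := D_pos hα hβ h t x x₁ x₂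
  unfold breather dx Btilde
  rw [(ha.const_mul (2 * √2)).deriv]
  congr 1
  refine Eq.trans ?_ hq.deriv.symm
  simp only [Complex.imCLM_apply, Complex.div_im, Complex.normSq_apply]
  unfold D at hD
  have h4 : F α β μ t x x₁ x₂ * F α β μ t x x₁ x₂ + G α β μ t x x₁ x₂ * G α β μ t x x₁ x₂ ≠ 0 := by
    nlinarith
  simp only [Pi.div_apply]
  field_simp

end

end Gardner

namespace Gardner

/-! ### Fields and their derivatives along the two shifts -/

/-! At fixed `t`, `F` and `G` depend on `x`, `x₁`, `x₂` only through `y₁` and `y₂`, so `∂ₓ = ∂₁ +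
∂₂`; `HasShiftDeriv` carries this through products, quotients, logarithms and arguments. Put `k =
amp`, `Γ = ratio`, `S = α² + β²` and `G = Γ H`. Then `F` and `H` are linear combinations of `β cos`,
`β sin / α`, `cosh`, `β sinh` with coefficients polynomial in `k` and `β`, and `Γ² = 1 + k² S`. The
gradient of `arg (F + iG)` in the shifts is `Γ (P / D, Q / D)`, where `P = F H₁ - H F₁`, `Q = F H₂ -
H F₂`, `D = F² + Γ² H²`.

First formula: `B₁` and `B₂` are the `x`-derivatives of `2√2 Γ P / D` and `2√2 Γ Q / D`. Since
`W[u', v'] = W[1, u, v]`, and a common factor `1 / D` leaves a `3 × 3` Wronskian as a factor `1 /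
D³`, the determinant is `8 Γ² W[D, P, Q] / D³` (`det_wronskian_of_potential`). Modulo `cos² + sin² =
1` and `cosh² - sinh² = 1`, `W[D, P, Q]` equals `D` times the quadratic polynomial `profile`
(`det_wronskian_numerators`), which double-angle formulas turn into the stated bracket
(`profile_eq`).

Second formula: the right side has denominator `D³`. Lagrange's identity `D₁ Dₓ + 4 Γ² P (P + Q) = 4
D E`, with `E = F₁ Fₓ + Γ² H₁ Hₓ`, cancels one factor `D`, and what remains again reduces to
`profile` (`logDeriv_numerator`, `second_form_of_numerators`). Both expressions thus equal `8 Γ²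
profile / D²`. -/

/-- A scalar field, written `f t x x₁ x₂`. -/
abbrev Field : Type := ℝ → ℝ → ℝ → ℝ → ℝ

/-- The constant field. -/
def cst (a : ℝ) : Field := fun _ _ _ _ => a

/-- The field `f` has partial derivatives `f₁` and `f₂` in the shifts, and `f₁ + f₂` in `x`. -/
structure HasShiftDeriv (f f₁ f₂ : Field) : Prop where
  left : ∀ t x x₁ x₂, HasDerivAt (fun s => f t x s x₂) (f₁ t x x₁ x₂) x₁
  right : ∀ t x x₁ x₂, HasDerivAt (fun s => f t x x₁ s) (f₂ t x x₁ x₂) x₂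
  space : ∀ t x x₁ x₂, HasDerivAt (fun s => f t s x₁ x₂) (f₁ t x x₁ x₂ + f₂ t x x₁ x₂) x

namespace HasShiftDeriv

variable {f f₁ f₂ g g₁ g₂ : Field}

theorem d₁_eq (h : HasShiftDeriv f f₁ f₂) : d₁ f = f₁ := by
  funext t x x₁ x₂; exact (h.left t x x₁ x₂).deriv

theorem d₂_eq (h : HasShiftDeriv f f₁ f₂) : d₂ f = f₂ := by
  funext t x x₁ x₂; exact (h.right t x x₁ x₂).deriv

theorem dx_eq (h : HasShiftDeriv f f₁ f₂) : dx f = f₁ + f₂ := by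
  funext t x x₁ x₂; exact (h.space t x x₁ x₂).deriv

theorem const (a : ℝ) : HasShiftDeriv (cst a) 0 0 where
  left _ _ _ _ := hasDerivAt_const _ _
  right _ _ _ _ := hasDerivAt_const _ _
  space _ x _ _ := (hasDerivAt_const x a).congr_deriv (add_zero (0 : ℝ)).symm

theorem zero : HasShiftDeriv 0 0 0 := const 0

theorem add (hf : HasShiftDeriv f f₁ f₂) (hg : HasShiftDeriv g g₁ g₂) :
    HasShiftDeriv (f + g) (f₁ + g₁) (f₂ + g₂) where
  left t x x₁ x₂ := (hf.left t x x₁ x₂).add (hg.left t x x₁ x₂)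
  right t x x₁ x₂ := (hf.right t x x₁ x₂).add (hg.right t x x₁ x₂)
  space t x x₁ x₂ :=
    ((hf.space t x x₁ x₂).add (hg.space t x x₁ x₂)).congr_deriv (by
      simp only [Pi.add_apply]; ring)

theorem mul (hf : HasShiftDeriv f f₁ f₂) (hg : HasShiftDeriv g g₁ g₂) :
    HasShiftDeriv (f * g) (f₁ * g + f * g₁) (f₂ * g + f * g₂) where
  left t x x₁ x₂ := (hf.left t x x₁ x₂).mul (hg.left t x x₁ x₂)
  right t x x₁ x₂ := (hf.right t x x₁ x₂).mul (hg.right t x x₁ x₂)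
  space t x x₁ x₂ :=
    ((hf.space t x x₁ x₂).mul (hg.space t x x₁ x₂)).congr_deriv (by
      simp only [Pi.add_apply, Pi.mul_apply]; ring)

theorem const_mul (a : ℝ) (hf : HasShiftDeriv f f₁ f₂) :
    HasShiftDeriv (cst a * f) (cst a * f₁) (cst a * f₂) := by
  simpa using (const a).mul hf

theorem sub (hf : HasShiftDeriv f f₁ f₂) (hg : HasShiftDeriv g g₁ g₂) :
    HasShiftDeriv (f - g) (f₁ - g₁) (f₂ - g₂) where
  left t x x₁ x₂ := (hf.left t x x₁ x₂).sub (hg.left t x x₁ x₂)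
  right t x x₁ x₂ := (hf.right t x x₁ x₂).sub (hg.right t x x₁ x₂)
  space t x x₁ x₂ :=
    ((hf.space t x x₁ x₂).sub (hg.space t x x₁ x₂)).congr_deriv (by
      simp only [Pi.sub_apply]; ring)

theorem div (hf : HasShiftDeriv f f₁ f₂) (hg : HasShiftDeriv g g₁ g₂)
    (h0 : ∀ t x x₁ x₂, g t x x₁ x₂ ≠ 0) :
    HasShiftDeriv (f / g) ((f₁ * g - f * g₁) / g ^ 2) ((f₂ * g - f * g₂) / g ^ 2) where
  left t x x₁ x₂ := (hf.left t x x₁ x₂).div (hg.left t x x₁ x₂) (h0 t x x₁ x₂)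
  right t x x₁ x₂ := (hf.right t x x₁ x₂).div (hg.right t x x₁ x₂) (h0 t x x₁ x₂)
  space t x x₁ x₂ :=
    ((hf.space t x x₁ x₂).div (hg.space t x x₁ x₂) (h0 t x x₁ x₂)).congr_deriv (by
      simp only [Pi.sub_apply, Pi.mul_apply, Pi.div_apply, Pi.pow_apply]; ring)

theorem log (hf : HasShiftDeriv f f₁ f₂) (h0 : ∀ t x x₁ x₂, f t x x₁ x₂ ≠ 0) :
    HasShiftDeriv (fun t x x₁ x₂ => Real.log (f t x x₁ x₂)) (f₁ / f) (f₂ / f) where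
  left t x x₁ x₂ := (hf.left t x x₁ x₂).log (h0 t x x₁ x₂)
  right t x x₁ x₂ := (hf.right t x x₁ x₂).log (h0 t x x₁ x₂)
  space t x x₁ x₂ :=
    ((hf.space t x x₁ x₂).log (h0 t x x₁ x₂)).congr_deriv (by
      simp only [Pi.div_apply]; ring)

/-- The derivative of `arg z` is `Im (z' / z)`, as `arg` is the imaginary part of `log`; zeros of
the real part do no harm. -/
theorem _root_.HasDerivAt.arg_mk {a b : ℝ → ℝ} {a' b' s : ℝ} (ha : HasDerivAt a a' s)
    (hb : HasDerivAt b b' s) (hm : (⟨a s, b s⟩ : ℂ) ∈ Complex.slitPlane) :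
    HasDerivAt (fun r => Complex.arg ⟨a r, b r⟩)
      ((a s * b' - b s * a') / (a s ^ 2 + b s ^ 2)) s := by
  have hz : HasDerivAt (fun r => (⟨a r, b r⟩ : ℂ)) (⟨a', b'⟩ : ℂ) s :=
    Complex.equivRealProdCLM.symm.hasFDerivAt.comp_hasDerivAt s (ha.prodMk hb)
  have h : HasDerivAt (fun r => Complex.arg ⟨a r, b r⟩)
      (Complex.imCLM ((⟨a', b'⟩ : ℂ) / ⟨a s, b s⟩)) s := by
    simp only [← Complex.log_im]
    exact Complex.imCLM.hasFDerivAt.comp_hasDerivAt s (hz.clog_real hm)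
  convert h using 1
  simp only [Complex.imCLM_apply, Complex.div_im, Complex.normSq_apply]
  ring

theorem arg (hf : HasShiftDeriv f f₁ f₂) (hg : HasShiftDeriv g g₁ g₂)
    (hm : ∀ t x x₁ x₂, (⟨f t x x₁ x₂, g t x x₁ x₂⟩ : ℂ) ∈ Complex.slitPlane) :
    HasShiftDeriv (fun t x x₁ x₂ => Complex.arg ⟨f t x x₁ x₂, g t x x₁ x₂⟩)
      ((f * g₁ - g * f₁) / (f ^ 2 + g ^ 2)) ((f * g₂ - g * f₂) / (f ^ 2 + g ^ 2)) where
  left t x x₁ x₂ := (hf.left t x x₁ x₂).arg_mk (hg.left t x x₁ x₂) (hm t x x₁ x₂)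
  right t x x₁ x₂ := (hf.right t x x₁ x₂).arg_mk (hg.right t x x₁ x₂) (hm t x x₁ x₂)
  space t x x₁ x₂ :=
    ((hf.space t x x₁ x₂).arg_mk (hg.space t x x₁ x₂) (hm t x x₁ x₂)).congr_deriv (by
      simp only [Pi.sub_apply, Pi.mul_apply, Pi.div_apply, Pi.pow_apply, Pi.add_apply]; ring)

end HasShiftDeriv

/-! ### Separated fields with linear equations in each shift. -/

/-- The field `f` is a sum of a function of `x + x₁` and a function of `x + x₂` (up to `t`), whose
derivatives `f₁`, `f₁₁` and `f₂`, `f₂₂` satisfy `f₁₁₁ = -A f₁` and `f₂₂₂ = b² f₂`. -/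
structure IsJet (A b : ℝ) (f f₁ f₂ f₁₁ f₂₂ : Field) : Prop where
  h : HasShiftDeriv f f₁ f₂
  h₁ : HasShiftDeriv f₁ f₁₁ 0
  h₂ : HasShiftDeriv f₂ 0 f₂₂
  h₁₁ : HasShiftDeriv f₁₁ (-cst A * f₁) 0
  h₂₂ : HasShiftDeriv f₂₂ 0 (cst (b ^ 2) * f₂)

namespace IsJet

variable {A b : ℝ} {f f₁ f₂ f₁₁ f₂₂ g g₁ g₂ g₁₁ g₂₂ : Field}

theorem add (hf : IsJet A b f f₁ f₂ f₁₁ f₂₂) (hg : IsJet A b g g₁ g₂ g₁₁ g₂₂) :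
    IsJet A b (f + g) (f₁ + g₁) (f₂ + g₂) (f₁₁ + g₁₁) (f₂₂ + g₂₂) where
  h := hf.h.add hg.h
  h₁ := by simpa using hf.h₁.add hg.h₁
  h₂ := by simpa using hf.h₂.add hg.h₂
  h₁₁ := by convert hf.h₁₁.add hg.h₁₁ using 1 <;> ring
  h₂₂ := by convert hf.h₂₂.add hg.h₂₂ using 1 <;> ring

theorem const_mul (a : ℝ) (hf : IsJet A b f f₁ f₂ f₁₁ f₂₂) :
    IsJet A b (cst a * f) (cst a * f₁) (cst a * f₂) (cst a * f₁₁) (cst a * f₂₂) where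
  h := hf.h.const_mul a
  h₁ := by simpa using hf.h₁.const_mul a
  h₂ := by simpa using hf.h₂.const_mul a
  h₁₁ := by convert hf.h₁₁.const_mul a using 1 <;> ring
  h₂₂ := by convert hf.h₂₂.const_mul a using 1 <;> ring

end IsJet

/-! ### Quotient identities for a potential and for a logarithm. -/

/-- The Wronskian of the two shift derivatives of `c (P + Q) / D`, where `(P / D, Q / D)` is the
gradient of a potential, is a `3 × 3` Wronskian of `D, P, Q` over `D ^ 3`. -/
theorem det_wronskian_of_potential {P P₁ P₂ P₁' P₂' Q Q₁ Q₂ Q₁' Q₂' D D₁ D₂ D₁' D₂' : Field}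
    (c : ℝ) (hP : HasShiftDeriv P P₁ P₂) (hP' : HasShiftDeriv (P₁ + P₂) P₁' P₂')
    (hQ : HasShiftDeriv Q Q₁ Q₂) (hQ' : HasShiftDeriv (Q₁ + Q₂) Q₁' Q₂')
    (hD : HasShiftDeriv D D₁ D₂) (hD' : HasShiftDeriv (D₁ + D₂) D₁' D₂')
    (h0 : ∀ t x x₁ x₂, D t x x₁ x₂ ≠ 0)
    (hcl : P₂ * D - P * D₂ = Q₁ * D - Q * D₁)
    {B : Field} (hB : B = cst c * ((P + Q) / D)) (t x x₁ x₂ : ℝ) :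
    (wronskian (d₁ B) (d₂ B) t x x₁ x₂).det = c ^ 2 / D t x x₁ x₂ ^ 3 *
      Matrix.det !![D t x x₁ x₂, (D₁ + D₂) t x x₁ x₂, (D₁' + D₂') t x x₁ x₂;
        P t x x₁ x₂, (P₁ + P₂) t x x₁ x₂, (P₁' + P₂') t x x₁ x₂;
        Q t x x₁ x₂, (Q₁ + Q₂) t x x₁ x₂, (Q₁' + Q₂') t x x₁ x₂] := by
  have hBd := ((hP.add hQ).div hD h0).const_mul c
  -- Closedness of the gradient lets `∂₁` and `∂ₓ` be exchanged: `∂₁ B = c ∂ₓ (P / D)`, and likewise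
  -- `∂₂ B = c ∂ₓ (Q / D)`.
  have e₁ : (P₁ + Q₁) * D - (P + Q) * D₁ = (P₁ + P₂) * D - P * (D₁ + D₂) := by
    linear_combination -hcl
  have e₂ : (P₂ + Q₂) * D - (P + Q) * D₂ = (Q₁ + Q₂) * D - Q * (D₁ + D₂) := by
    linear_combination hcl
  rw [e₁, e₂, ← hB] at hBd
  have h2 : ∀ t x x₁ x₂, (D * D) t x x₁ x₂ ≠ 0 := fun t x x₁ x₂ =>
    mul_ne_zero (h0 t x x₁ x₂) (h0 t x x₁ x₂)
  have hN₁ := (((hP'.mul hD).sub (hP.mul hD')).div (hD.mul hD) h2).const_mul c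
  have hN₂ := (((hQ'.mul hD).sub (hQ.mul hD')).div (hD.mul hD) h2).const_mul c
  rw [← sq] at hN₁ hN₂
  rw [hBd.d₁_eq, hBd.d₂_eq]
  unfold wronskian
  rw [hN₁.dx_eq, hN₂.dx_eq, Matrix.det_fin_two_of, Matrix.det_fin_three]
  simp only [cst, Pi.add_apply, Pi.mul_apply, Pi.sub_apply, Pi.div_apply, Pi.pow_apply,
    Matrix.of_apply, Matrix.cons_val]
  have := h0 t x x₁ x₂
  field_simp
  ring

/-- The third logarithmic derivative `∂₁² ∂ₓ log D`. -/
theorem d₁_d₁_dx_log {D D₁ D₂ D₁₁ D₁₂ D₁' D₂' D₁₁' D₁₂' : Field}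
    (hD : HasShiftDeriv D D₁ D₂) (hD₁ : HasShiftDeriv D₁ D₁₁ D₁₂)
    (hD' : HasShiftDeriv (D₁ + D₂) D₁' D₂') (hD₁' : HasShiftDeriv D₁' D₁₁' D₁₂')
    (h0 : ∀ t x x₁ x₂, D t x x₁ x₂ ≠ 0) (t x x₁ x₂ : ℝ) :
    d₁ (d₁ (dx (fun t x x₁ x₂ => Real.log (D t x x₁ x₂)))) t x x₁ x₂
      = (D₁₁' t x x₁ x₂ * D t x x₁ x₂ ^ 2
          - 2 * D₁ t x x₁ x₂ * D₁' t x x₁ x₂ * D t x x₁ x₂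
          - D₁₁ t x x₁ x₂ * (D₁ + D₂) t x x₁ x₂ * D t x x₁ x₂
          + 2 * D₁ t x x₁ x₂ ^ 2 * (D₁ + D₂) t x x₁ x₂) / D t x x₁ x₂ ^ 3 := by
  have h2 : ∀ t x x₁ x₂, (D * D) t x x₁ x₂ ≠ 0 := fun t x x₁ x₂ =>
    mul_ne_zero (h0 t x x₁ x₂) (h0 t x x₁ x₂)
  have hx : dx (fun t x x₁ x₂ => Real.log (D t x x₁ x₂)) = (D₁ + D₂) / D := by
    rw [(hD.log h0).dx_eq]
    funext t x x₁ x₂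
    simp only [Pi.add_apply, Pi.div_apply]
    ring
  have hQ := ((hD₁'.mul hD).sub (hD'.mul hD₁)).div (hD.mul hD) h2
  rw [← sq] at hQ
  rw [hx, (hD'.div hD h0).d₁_eq, hQ.d₁_eq]
  simp only [Pi.add_apply, Pi.mul_apply, Pi.sub_apply, Pi.div_apply, Pi.pow_apply]
  have := h0 t x x₁ x₂
  field_simp
  ring

/-! ### Derivatives of the quadratic form `F² + g H²` and of the alternating forms `F H₁ - H F₁`, `F
H₂ - H F₂`. -/

section Jets

variable {A b g : ℝ} {F F₁ F₂ F₁₁ F₂₂ H H₁ H₂ H₁₁ H₂₂ : Field}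

theorem IsJet.quad (hF : IsJet A b F F₁ F₂ F₁₁ F₂₂) (hH : IsJet A b H H₁ H₂ H₁₁ H₂₂) :
    HasShiftDeriv (F * F + cst g * (H * H)) (cst 2 * (F * F₁ + cst g * (H * H₁)))
      (cst 2 * (F * F₂ + cst g * (H * H₂))) := by
  -- The numeral is needed for `ring` to merge the two equal terms from the product rule; `cst 2` is
  -- an atom for it.
  have e : (cst 2 : Field) = 2 := rfl
  convert (hF.h.mul hF.h).add ((hH.h.mul hH.h).const_mul g) using 1 <;> rw [e] <;> ring

theorem IsJet.quad₁ (hF : IsJet A b F F₁ F₂ F₁₁ F₂₂) (hH : IsJet A b H H₁ H₂ H₁₁ H₂₂) :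
    HasShiftDeriv (cst 2 * (F * F₁ + cst g * (H * H₁)))
      (cst 2 * (F₁ * F₁ + F * F₁₁ + cst g * (H₁ * H₁ + H * H₁₁)))
      (cst 2 * (F₁ * F₂ + cst g * (H₁ * H₂))) := by
  convert ((hF.h.mul hF.h₁).add ((hH.h.mul hH.h₁).const_mul g)).const_mul 2 using 1
  ring

theorem IsJet.quad₂ (hF : IsJet A b F F₁ F₂ F₁₁ F₂₂) (hH : IsJet A b H H₁ H₂ H₁₁ H₂₂) :
    HasShiftDeriv (cst 2 * (F * F₂ + cst g * (H * H₂)))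
      (cst 2 * (F₁ * F₂ + cst g * (H₁ * H₂)))
      (cst 2 * (F₂ * F₂ + F * F₂₂ + cst g * (H₂ * H₂ + H * H₂₂))) := by
  convert ((hF.h.mul hF.h₂).add ((hH.h.mul hH.h₂).const_mul g)).const_mul 2 using 1
  ring

/-- The third derivatives `F₁₁₁ = -A F₁` and `H₁₁₁ = -A H₁` are eliminated here, so only derivatives
up to second order remain. -/
theorem IsJet.quad₁₁ (hF : IsJet A b F F₁ F₂ F₁₁ F₂₂) (hH : IsJet A b H H₁ H₂ H₁₁ H₂₂) :
    HasShiftDeriv (cst 2 * (F₁ * F₁ + F * F₁₁ + cst g * (H₁ * H₁ + H * H₁₁)))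
      (cst 2 * (cst 3 * (F₁ * F₁₁ + cst g * (H₁ * H₁₁)) - cst A * (F * F₁ + cst g * (H * H₁))))
      (cst 2 * (F₂ * F₁₁ + cst g * (H₂ * H₁₁))) := by
  have e : (cst 3 : Field) = 3 := rfl
  convert (((hF.h₁.mul hF.h₁).add (hF.h.mul hF.h₁₁)).add
    (((hH.h₁.mul hH.h₁).add (hH.h.mul hH.h₁₁)).const_mul g)).const_mul 2 using 1 <;>
  (try rw [e]) <;> ring

theorem IsJet.quad₁₂ (hF : IsJet A b F F₁ F₂ F₁₁ F₂₂) (hH : IsJet A b H H₁ H₂ H₁₁ H₂₂) :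
    HasShiftDeriv (cst 2 * (F₁ * F₂ + cst g * (H₁ * H₂)))
      (cst 2 * (F₂ * F₁₁ + cst g * (H₂ * H₁₁)))
      (cst 2 * (F₁ * F₂₂ + cst g * (H₁ * H₂₂))) := by
  convert ((hF.h₁.mul hF.h₂).add ((hH.h₁.mul hH.h₂).const_mul g)).const_mul 2 using 1 <;> ring

/-- Antisymmetry cancels `F₁ H₁`, and separation of variables removes the mixed derivatives. These
are the numerators `P` and, in `alt₂`, `Q` of the gradient of the argument. -/
theorem IsJet.alt₁ (hF : IsJet A b F F₁ F₂ F₁₁ F₂₂) (hH : IsJet A b H H₁ H₂ H₁₁ H₂₂) :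
    HasShiftDeriv (F * H₁ - H * F₁) (F * H₁₁ - H * F₁₁) (F₂ * H₁ - H₂ * F₁) := by
  convert (hF.h.mul hH.h₁).sub (hH.h.mul hF.h₁) using 1 <;> ring

theorem IsJet.alt₂ (hF : IsJet A b F F₁ F₂ F₁₁ F₂₂) (hH : IsJet A b H H₁ H₂ H₁₁ H₂₂) :
    HasShiftDeriv (F * H₂ - H * F₂) (F₁ * H₂ - H₁ * F₂) (F * H₂₂ - H * F₂₂) := by
  convert (hF.h.mul hH.h₂).sub (hH.h.mul hF.h₂) using 1 <;> ring

theorem IsJet.alt₁' (hF : IsJet A b F F₁ F₂ F₁₁ F₂₂) (hH : IsJet A b H H₁ H₂ H₁₁ H₂₂) :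
    HasShiftDeriv ((F * H₁₁ - H * F₁₁) + (F₂ * H₁ - H₂ * F₁))
      (F₁ * H₁₁ - H₁ * F₁₁ - cst A * (F * H₁ - H * F₁) + (F₂ * H₁₁ - H₂ * F₁₁))
      ((F₂ * H₁₁ - H₂ * F₁₁) + (F₂₂ * H₁ - H₂₂ * F₁)) := by
  convert ((hF.h.mul hH.h₁₁).sub (hH.h.mul hF.h₁₁)).add
    ((hF.h₂.mul hH.h₁).sub (hH.h₂.mul hF.h₁)) using 1 <;> ring

theorem IsJet.alt₂' (hF : IsJet A b F F₁ F₂ F₁₁ F₂₂) (hH : IsJet A b H H₁ H₂ H₁₁ H₂₂) :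
    HasShiftDeriv ((F₁ * H₂ - H₁ * F₂) + (F * H₂₂ - H * F₂₂))
      ((F₁₁ * H₂ - H₁₁ * F₂) + (F₁ * H₂₂ - H₁ * F₂₂))
      ((F₁ * H₂₂ - H₁ * F₂₂) + (F₂ * H₂₂ - H₂ * F₂₂ + cst (b ^ 2) * (F * H₂ - H * F₂))) := by
  convert ((hF.h₁.mul hH.h₂).sub (hH.h₁.mul hF.h₂)).add
    ((hF.h.mul hH.h₂₂).sub (hH.h.mul hF.h₂₂)) using 1 <;> ring

end Jets

/-! ### Polynomial identities modulo the two Pythagorean relations. -/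

/-- The quadratic form to which the Wronskian of the kernel elements reduces. -/
noncomputable def profile (A b k p v c σ : ℝ) : ℝ :=
  -(1 / 2) * b ^ 2 * (A + b ^ 2) *
    (2 * p * v * (1 + 2 * b ^ 2 * k ^ 2 * (1 + k ^ 2 * (A + b ^ 2)))
      + 2 * k ^ 2 * b ^ 3 * (1 + k ^ 2 * (A + b ^ 2)) * (2 * p ^ 2 - 1)
      - 2 * σ * c * (1 + 2 * k ^ 2 * b ^ 2) + 2 * b ^ 3 * k ^ 2 - 4 * b * k ^ 2 * A * σ ^ 2)

set_option maxHeartbeats 2000000 in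
/-- The `3 × 3` Wronskian of the denominator `D` and the two numerators `P`, `Q` is divisible by `D`. -/
theorem det_wronskian_numerators {c σ p v k A b : ℝ} (hc : c ^ 2 + A * σ ^ 2 = b ^ 2)
    (hv : v ^ 2 + b ^ 2 = b ^ 2 * p ^ 2)
    {F F₁ F₁₁ F₂₂ H H₂ H₁₁ H₂₂ g : ℝ}
    (hF : F = p + -k * c + k * b * σ) (hF₁ : F₁ = k * A * σ + k * b * c) (hF₁₁ : F₁₁ = k * A * c
    - k * b * A * σ) (hF₂₂ : F₂₂ = b ^ 2 * p) (hH : H = σ + -(k * b) * p + -k * v) (hH₂ : H₂ =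
    -(k * b) * v - k * b ^ 2 * p) (hH₁₁ : H₁₁ = -A * σ) (hH₂₂ : H₂₂ = -(k * b ^ 3) * p - k * b ^
    2 * v) (hg : g = 1 + k ^ 2 * (A + b ^ 2))
    {D Dx Dxx P Px Pxx Q Qx Qxx : ℝ}
    (hD : D = F * F + g * (H * H)) (hDx : Dx = 2 * (F * F₁ + g * (H * c)) + 2 * (F * v + g * (H
    * H₂))) (hDxx : Dxx = 2 * (F₁ * F₁ + F * F₁₁ + g * (c * c + H * H₁₁)) + 4 * (F₁ * v + g * (c
    * H₂)) + 2 * (v * v + F * F₂₂ + g * (H₂ * H₂ + H * H₂₂))) (hP : P = F * c - H * F₁) (hPx :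
    Px = F * H₁₁ - H * F₁₁ + (v * c - H₂ * F₁)) (hPxx : Pxx = F₁ * H₁₁ - c * F₁₁ - A * (F * c -
    H * F₁) + 2 * (v * H₁₁ - H₂ * F₁₁) + (F₂₂ * c - H₂₂ * F₁)) (hQ : Q = F * H₂ - H * v) (hQx :
    Qx = F₁ * H₂ - c * v + (F * H₂₂ - H * F₂₂)) (hQxx : Qxx = F₁₁ * H₂ - H₁₁ * v + 2 * (F₁ * H₂₂
    - c * F₂₂) + (v * H₂₂ - H₂ * F₂₂) + b ^ 2 * (F * H₂ - H * v)) :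
    Matrix.det !![D, Dx, Dxx; P, Px, Pxx; Q, Qx, Qxx] = D * profile A b k p v c σ := by
  unfold profile
  rw [Matrix.det_fin_three]
  simp only [Matrix.of_apply, Matrix.cons_val]
  subst hF hF₁ hF₁₁ hF₂₂ hH hH₂ hH₁₁ hH₂₂ hg
  -- Each entry is first put in normal form, with `c²` and `v²` eliminated through `hc` and `hv`;
  -- this keeps the final certificate smaller.
  replace hD : D = -2 * c * σ * k ^ 2 * b - 2 * c * p * k + 2 * σ ^ 2 * k ^ 2 * b ^ 2 + σ ^ 2 -
      2 * σ * p * k ^ 3 * A * b - 2 * σ * p * k ^ 3 * b ^ 3 - 2 * σ * v * k ^ 3 * A - 2 * σ * v * k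
      ^ 3 * b ^ 2 - 2 * σ * v * k + 2 * p ^ 2 * k ^ 4 * A * b ^ 2 + 2 * p ^ 2 * k ^ 4 * b ^ 4 + 2 *
      p ^ 2 * k ^ 2 * b ^ 2 + p ^ 2 + 2 * p * v * k ^ 4 * A * b + 2 * p * v * k ^ 4 * b ^ 3 + 2 * p
      * v * k ^ 2 * b - k ^ 4 * A * b ^ 2 - k ^ 4 * b ^ 4 := by
    rw [hD]
    linear_combination (k ^ 2) * hc + (k ^ 4 * A + k ^ 4 * b ^ 2 + k ^ 2) * hv
  replace hDx : Dx = 4 * c * σ * k ^ 2 * b ^ 2 + 2 * c * σ - 2 * c * p * k ^ 3 * A * b - 2 * c *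
      p * k ^ 3 * b ^ 3 - 2 * c * v * k ^ 3 * A - 2 * c * v * k ^ 3 * b ^ 2 - 4 * c * v * k + 4 * σ
      ^ 2 * k ^ 2 * A * b - 2 * σ * p * k ^ 3 * A * b ^ 2 - 2 * σ * p * k ^ 3 * b ^ 4 + 2 * σ * p *
      k * A - 2 * σ * p * k * b ^ 2 - 2 * σ * v * k ^ 3 * A * b - 2 * σ * v * k ^ 3 * b ^ 3 + 4 * p
      ^ 2 * k ^ 4 * A * b ^ 3 + 4 * p ^ 2 * k ^ 4 * b ^ 5 + 4 * p ^ 2 * k ^ 2 * b ^ 3 + 4 * p * v *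
      k ^ 4 * A * b ^ 2 + 4 * p * v * k ^ 4 * b ^ 4 + 4 * p * v * k ^ 2 * b ^ 2 + 2 * p * v - 2 * k
      ^ 4 * A * b ^ 3 - 2 * k ^ 4 * b ^ 5 - 4 * k ^ 2 * b ^ 3 := by
    rw [hDx]
    linear_combination (-2 * k ^ 2 * b) * hc + (2 * k ^ 4 * A * b + 2 * k ^ 4 * b ^ 3 + 2 * k ^
      2 * b) * hv
  replace hDxx : Dxx = 8 * c * σ * k ^ 2 * A * b - 4 * c * p * k ^ 3 * A * b ^ 2 - 4 * c * p * k
      ^ 3 * b ^ 4 + 2 * c * p * k * A - 6 * c * p * k * b ^ 2 - 4 * c * v * k ^ 3 * A * b - 4 * c *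
      v * k ^ 3 * b ^ 3 - 8 * σ ^ 2 * k ^ 2 * A * b ^ 2 - 4 * σ ^ 2 * A + 2 * σ * p * k ^ 3 * A ^ 2
      * b - 2 * σ * p * k ^ 3 * b ^ 5 + 2 * σ * v * k ^ 3 * A ^ 2 - 2 * σ * v * k ^ 3 * b ^ 4 + 6 *
      σ * v * k * A - 2 * σ * v * k * b ^ 2 + 8 * p ^ 2 * k ^ 4 * A * b ^ 4 + 8 * p ^ 2 * k ^ 4 * b
      ^ 6 + 8 * p ^ 2 * k ^ 2 * b ^ 4 + 4 * p ^ 2 * b ^ 2 + 8 * p * v * k ^ 4 * A * b ^ 3 + 8 * p *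
      v * k ^ 4 * b ^ 5 + 8 * p * v * k ^ 2 * b ^ 3 - 4 * k ^ 4 * A * b ^ 4 - 4 * k ^ 4 * b ^ 6 :=
      by
    rw [hDxx]
    linear_combination (4 * k ^ 2 * b ^ 2 + 2) * hc + (4 * k ^ 4 * A * b ^ 2 + 4 * k ^ 4 * b ^ 4
      + 4 * k ^ 2 * b ^ 2 + 2) * hv
  replace hP : P = c * p * k ^ 2 * b ^ 2 + c * p + c * v * k ^ 2 * b + σ * p * k ^ 2 * A * b + σ
      * v * k ^ 2 * A - k * b ^ 2 := by
    rw [hP]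
    linear_combination (-k) * hc
  replace hPx : Px = c * p * k ^ 2 * A * b + c * p * k ^ 2 * b ^ 3 + c * v * k ^ 2 * A + c * v *
      k ^ 2 * b ^ 2 + c * v - σ * p * A := by
    rw [hPx]
    linear_combination
  replace hPxx : Pxx = c * p * k ^ 2 * A * b ^ 2 + c * p * k ^ 2 * b ^ 4 - c * p * A + c * p * b
      ^ 2 + c * v * k ^ 2 * A * b + c * v * k ^ 2 * b ^ 3 - σ * p * k ^ 2 * A ^ 2 * b - σ * p * k ^
      2 * A * b ^ 3 - σ * v * k ^ 2 * A ^ 2 - σ * v * k ^ 2 * A * b ^ 2 - 2 * σ * v * A := by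
    rw [hPxx]
    linear_combination
  replace hQ : Q = c * p * k ^ 2 * b ^ 2 + c * v * k ^ 2 * b - σ * p * k ^ 2 * b ^ 3 - σ * v * k
      ^ 2 * b ^ 2 - σ * v - k * b ^ 2 := by
    rw [hQ]
    linear_combination (k) * hv
  replace hQx : Qx = -c * v - σ * p * k ^ 2 * A * b ^ 2 - σ * p * k ^ 2 * b ^ 4 - σ * p * b ^ 2
      - σ * v * k ^ 2 * A * b - σ * v * k ^ 2 * b ^ 3 := by
    rw [hQx]
    linear_combination
  replace hQxx : Qxx = -c * p * k ^ 2 * A * b ^ 2 - c * p * k ^ 2 * b ^ 4 - 2 * c * p * b ^ 2 -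
      c * v * k ^ 2 * A * b - c * v * k ^ 2 * b ^ 3 - σ * p * k ^ 2 * A * b ^ 3 - σ * p * k ^ 2 * b
      ^ 5 - σ * v * k ^ 2 * A * b ^ 2 - σ * v * k ^ 2 * b ^ 4 + σ * v * A - σ * v * b ^ 2 := by
    rw [hQxx]
    linear_combination
  rw [hD, hDx, hDxx, hP, hPx, hPxx, hQ, hQx, hQxx]
  -- Both sides agree modulo the ideal generated by the two relations; the two long factors are the
  -- cofactors of `hc` and `hv`.
  linear_combination
    (-6 * c * σ * p ^ 2 * k ^ 6 * A ^ 2 * b ^ 4 + 4 * c * σ * p ^ 2 * k ^ 6 * A * b ^ 6 + 10 * c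
    * σ * p ^ 2 * k ^ 6 * b ^ 8 + 8 * c * σ * p ^ 2 * k ^ 4 * A * b ^ 4 + 24 * c * σ * p ^ 2 * k
    ^ 4 * b ^ 6 + 16 * c * σ * p ^ 2 * k ^ 2 * b ^ 4 + 4 * c * σ * p ^ 2 * b ^ 2 - 12 * c * σ *
    p * v * k ^ 6 * A ^ 2 * b ^ 3 + 8 * c * σ * p * v * k ^ 6 * A * b ^ 5 + 20 * c * σ * p * v *
    k ^ 6 * b ^ 7 - 4 * c * σ * p * v * k ^ 4 * A * b ^ 3 + 28 * c * σ * p * v * k ^ 4 * b ^ 5 -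
    6 * c * σ * p * v * k ^ 2 * A * b + 10 * c * σ * p * v * k ^ 2 * b ^ 3 - 6 * c * σ * v ^ 2 *
    k ^ 6 * A ^ 2 * b ^ 2 + 4 * c * σ * v ^ 2 * k ^ 6 * A * b ^ 4 + 10 * c * σ * v ^ 2 * k ^ 6 *
    b ^ 6 - 12 * c * σ * v ^ 2 * k ^ 4 * A * b ^ 2 + 4 * c * σ * v ^ 2 * k ^ 4 * b ^ 4 + 14 * σ
    ^ 2 * p ^ 2 * k ^ 6 * A ^ 2 * b ^ 5 + 12 * σ ^ 2 * p ^ 2 * k ^ 6 * A * b ^ 7 - 2 * σ ^ 2 * p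
    ^ 2 * k ^ 6 * b ^ 9 + 3 * σ ^ 2 * p ^ 2 * k ^ 4 * A ^ 2 * b ^ 3 + 10 * σ ^ 2 * p ^ 2 * k ^ 4
    * A * b ^ 5 - 9 * σ ^ 2 * p ^ 2 * k ^ 4 * b ^ 7 + 4 * σ ^ 2 * p ^ 2 * k ^ 2 * A * b ^ 3 - 4
    * σ ^ 2 * p ^ 2 * k ^ 2 * b ^ 5 + 28 * σ ^ 2 * p * v * k ^ 6 * A ^ 2 * b ^ 4 + 24 * σ ^ 2 *
    p * v * k ^ 6 * A * b ^ 6 - 4 * σ ^ 2 * p * v * k ^ 6 * b ^ 8 + 6 * σ ^ 2 * p * v * k ^ 4 *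
    A ^ 2 * b ^ 2 + 32 * σ ^ 2 * p * v * k ^ 4 * A * b ^ 4 - 6 * σ ^ 2 * p * v * k ^ 4 * b ^ 6 +
    12 * σ ^ 2 * p * v * k ^ 2 * A * b ^ 2 - 4 * σ ^ 2 * p * v * k ^ 2 * b ^ 4 + 3 * σ ^ 2 * p *
    v * A - σ ^ 2 * p * v * b ^ 2 + 14 * σ ^ 2 * v ^ 2 * k ^ 6 * A ^ 2 * b ^ 3 + 12 * σ ^ 2 * v
    ^ 2 * k ^ 6 * A * b ^ 5 - 2 * σ ^ 2 * v ^ 2 * k ^ 6 * b ^ 7 + 3 * σ ^ 2 * v ^ 2 * k ^ 4 * A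
    ^ 2 * b + 22 * σ ^ 2 * v ^ 2 * k ^ 4 * A * b ^ 3 + 3 * σ ^ 2 * v ^ 2 * k ^ 4 * b ^ 5 + 10 *
    σ ^ 2 * v ^ 2 * k ^ 2 * A * b + 2 * σ ^ 2 * v ^ 2 * k ^ 2 * b ^ 3 + 4 * σ ^ 2 * k ^ 4 * A *
    b ^ 5 + 4 * σ ^ 2 * k ^ 4 * b ^ 7 + 2 * σ ^ 2 * k ^ 2 * A * b ^ 3 + 2 * σ ^ 2 * k ^ 2 * b ^
    5 + 8 * σ * p * k ^ 5 * A ^ 2 * b ^ 4 - 8 * σ * p * k ^ 5 * b ^ 8 + 4 * σ * p * k ^ 3 * A *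
    b ^ 4 - 12 * σ * p * k ^ 3 * b ^ 6 + 4 * σ * p * k * A * b ^ 2 - 4 * σ * p * k * b ^ 4 + 8 *
    σ * v * k ^ 5 * A ^ 2 * b ^ 3 - 8 * σ * v * k ^ 5 * b ^ 7 + 12 * σ * v * k ^ 3 * A * b ^ 3 -
    4 * σ * v * k ^ 3 * b ^ 5 - 2 * p ^ 4 * k ^ 8 * A ^ 3 * b ^ 5 - 6 * p ^ 4 * k ^ 8 * A ^ 2 *
    b ^ 7 - 6 * p ^ 4 * k ^ 8 * A * b ^ 9 - 2 * p ^ 4 * k ^ 8 * b ^ 11 - 6 * p ^ 4 * k ^ 6 * A ^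
    2 * b ^ 5 + 4 * p ^ 4 * k ^ 6 * A * b ^ 7 + 10 * p ^ 4 * k ^ 6 * b ^ 9 - p ^ 4 * k ^ 4 * A ^
    2 * b ^ 3 - 2 * p ^ 4 * k ^ 4 * A * b ^ 5 + 15 * p ^ 4 * k ^ 4 * b ^ 7 - 2 * p ^ 4 * k ^ 2 *
    A * b ^ 3 + 6 * p ^ 4 * k ^ 2 * b ^ 5 - 6 * p ^ 3 * v * k ^ 8 * A ^ 3 * b ^ 4 - 18 * p ^ 3 *
    v * k ^ 8 * A ^ 2 * b ^ 6 - 18 * p ^ 3 * v * k ^ 8 * A * b ^ 8 - 6 * p ^ 3 * v * k ^ 8 * b ^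
    10 - 14 * p ^ 3 * v * k ^ 6 * A ^ 2 * b ^ 4 - 12 * p ^ 3 * v * k ^ 6 * A * b ^ 6 + 2 * p ^ 3
    * v * k ^ 6 * b ^ 8 - 4 * p ^ 3 * v * k ^ 4 * A ^ 2 * b ^ 2 - 20 * p ^ 3 * v * k ^ 4 * A * b
    ^ 4 - 4 * p ^ 3 * v * k ^ 2 * A * b ^ 2 - 4 * p ^ 3 * v * k ^ 2 * b ^ 4 - p ^ 3 * v * A - p
    ^ 3 * v * b ^ 2 - 6 * p ^ 2 * v ^ 2 * k ^ 8 * A ^ 3 * b ^ 3 - 18 * p ^ 2 * v ^ 2 * k ^ 8 * A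
    ^ 2 * b ^ 5 - 18 * p ^ 2 * v ^ 2 * k ^ 8 * A * b ^ 7 - 6 * p ^ 2 * v ^ 2 * k ^ 8 * b ^ 9 -
    10 * p ^ 2 * v ^ 2 * k ^ 6 * A ^ 2 * b ^ 3 - 36 * p ^ 2 * v ^ 2 * k ^ 6 * A * b ^ 5 - 26 * p
    ^ 2 * v ^ 2 * k ^ 6 * b ^ 7 - 3 * p ^ 2 * v ^ 2 * k ^ 4 * A ^ 2 * b - 14 * p ^ 2 * v ^ 2 * k
    ^ 4 * A * b ^ 3 - 27 * p ^ 2 * v ^ 2 * k ^ 4 * b ^ 5 - 2 * p ^ 2 * v ^ 2 * k ^ 2 * A * b -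
    10 * p ^ 2 * v ^ 2 * k ^ 2 * b ^ 3 + p ^ 2 * k ^ 8 * A ^ 3 * b ^ 5 + 3 * p ^ 2 * k ^ 8 * A ^
    2 * b ^ 7 + 3 * p ^ 2 * k ^ 8 * A * b ^ 9 + p ^ 2 * k ^ 8 * b ^ 11 + 2 * p ^ 2 * k ^ 6 * A ^
    2 * b ^ 5 - 12 * p ^ 2 * k ^ 6 * A * b ^ 7 - 14 * p ^ 2 * k ^ 6 * b ^ 9 - 4 * p ^ 2 * k ^ 4
    * A * b ^ 5 - 20 * p ^ 2 * k ^ 4 * b ^ 7 - 8 * p ^ 2 * k ^ 2 * b ^ 5 - 2 * p * v ^ 3 * k ^ 8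
    * A ^ 3 * b ^ 2 - 6 * p * v ^ 3 * k ^ 8 * A ^ 2 * b ^ 4 - 6 * p * v ^ 3 * k ^ 8 * A * b ^ 6
    - 2 * p * v ^ 3 * k ^ 8 * b ^ 8 - 2 * p * v ^ 3 * k ^ 6 * A ^ 2 * b ^ 2 - 20 * p * v ^ 3 * k
    ^ 6 * A * b ^ 4 - 18 * p * v ^ 3 * k ^ 6 * b ^ 6 + 4 * p * v ^ 3 * k ^ 4 * A * b ^ 2 - 12 *
    p * v ^ 3 * k ^ 4 * b ^ 4 + 2 * p * v * k ^ 8 * A ^ 3 * b ^ 4 + 6 * p * v * k ^ 8 * A ^ 2 *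
    b ^ 6 + 6 * p * v * k ^ 8 * A * b ^ 8 + 2 * p * v * k ^ 8 * b ^ 10 + 2 * p * v * k ^ 6 * A ^
    2 * b ^ 4 - 12 * p * v * k ^ 6 * A * b ^ 6 - 14 * p * v * k ^ 6 * b ^ 8 + p * v * k ^ 4 * A
    ^ 2 * b ^ 2 + 6 * p * v * k ^ 4 * A * b ^ 4 - 11 * p * v * k ^ 4 * b ^ 6 + v ^ 2 * k ^ 8 * A
    ^ 3 * b ^ 3 + 3 * v ^ 2 * k ^ 8 * A ^ 2 * b ^ 5 + 3 * v ^ 2 * k ^ 8 * A * b ^ 7 + v ^ 2 * k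
    ^ 8 * b ^ 9) * hc
    + (4 * c * σ ^ 3 * k ^ 4 * A ^ 2 * b ^ 2 - 4 * c * σ ^ 3 * k ^ 4 * b ^ 6 - 4 * c * σ ^ 3 * k
    ^ 2 * A * b ^ 2 - 4 * c * σ ^ 3 * k ^ 2 * b ^ 4 - c * σ ^ 3 * A - c * σ ^ 3 * b ^ 2 - 20 * c
    * σ * p ^ 2 * k ^ 6 * A ^ 2 * b ^ 4 - 8 * c * σ * p ^ 2 * k ^ 6 * A * b ^ 6 + 12 * c * σ * p
    ^ 2 * k ^ 6 * b ^ 8 - 2 * c * σ * p ^ 2 * k ^ 4 * A ^ 2 * b ^ 2 - 16 * c * σ * p ^ 2 * k ^ 4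
    * A * b ^ 4 + 18 * c * σ * p ^ 2 * k ^ 4 * b ^ 6 - 4 * c * σ * p ^ 2 * k ^ 2 * A * b ^ 2 +
    12 * c * σ * p ^ 2 * k ^ 2 * b ^ 4 - c * σ * p ^ 2 * A + 3 * c * σ * p ^ 2 * b ^ 2 - 20 * c
    * σ * p * v * k ^ 6 * A ^ 2 * b ^ 3 - 8 * c * σ * p * v * k ^ 6 * A * b ^ 5 + 12 * c * σ * p
    * v * k ^ 6 * b ^ 7 - 2 * c * σ * p * v * k ^ 4 * A ^ 2 * b - 16 * c * σ * p * v * k ^ 4 * A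
    * b ^ 3 + 18 * c * σ * p * v * k ^ 4 * b ^ 5 - 10 * c * σ * p * v * k ^ 2 * A * b + 6 * c *
    σ * p * v * k ^ 2 * b ^ 3 + 4 * c * σ * k ^ 6 * A ^ 2 * b ^ 4 + 8 * c * σ * k ^ 6 * A * b ^
    6 + 4 * c * σ * k ^ 6 * b ^ 8 + c * σ * k ^ 4 * A ^ 2 * b ^ 2 + 2 * c * σ * k ^ 4 * A * b ^
    4 + c * σ * k ^ 4 * b ^ 6 + 16 * c * p * k ^ 5 * A * b ^ 5 + 16 * c * p * k ^ 5 * b ^ 7 - 4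
    * c * p * k ^ 3 * A * b ^ 3 + 12 * c * p * k ^ 3 * b ^ 5 - 8 * σ ^ 4 * k ^ 4 * A ^ 2 * b ^ 3
    - 8 * σ ^ 4 * k ^ 4 * A * b ^ 5 - 4 * σ ^ 4 * k ^ 2 * A ^ 2 * b - 4 * σ ^ 4 * k ^ 2 * A * b
    ^ 3 - 4 * σ ^ 2 * p ^ 2 * k ^ 6 * A ^ 3 * b ^ 3 + 24 * σ ^ 2 * p ^ 2 * k ^ 6 * A ^ 2 * b ^ 5
    + 28 * σ ^ 2 * p ^ 2 * k ^ 6 * A * b ^ 7 + 4 * σ ^ 2 * p ^ 2 * k ^ 4 * A ^ 2 * b ^ 3 + 36 *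
    σ ^ 2 * p ^ 2 * k ^ 4 * A * b ^ 5 - 2 * σ ^ 2 * p ^ 2 * k ^ 2 * A ^ 2 * b + 14 * σ ^ 2 * p ^
    2 * k ^ 2 * A * b ^ 3 - 4 * σ ^ 2 * p * v * k ^ 6 * A ^ 3 * b ^ 2 + 24 * σ ^ 2 * p * v * k ^
    6 * A ^ 2 * b ^ 4 + 28 * σ ^ 2 * p * v * k ^ 6 * A * b ^ 6 + 4 * σ ^ 2 * p * v * k ^ 4 * A ^
    2 * b ^ 2 + 36 * σ ^ 2 * p * v * k ^ 4 * A * b ^ 4 + 16 * σ ^ 2 * p * v * k ^ 2 * A * b ^ 2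
    + 4 * σ ^ 2 * p * v * A + 2 * σ ^ 2 * k ^ 6 * A ^ 3 * b ^ 3 + 2 * σ ^ 2 * k ^ 6 * A ^ 2 * b
    ^ 5 - 2 * σ ^ 2 * k ^ 6 * A * b ^ 7 - 2 * σ ^ 2 * k ^ 6 * b ^ 9 - σ ^ 2 * k ^ 4 * A ^ 2 * b
    ^ 3 + 2 * σ ^ 2 * k ^ 4 * A * b ^ 5 + 3 * σ ^ 2 * k ^ 4 * b ^ 7 + 2 * σ ^ 2 * k ^ 2 * A * b
    ^ 3 + 2 * σ ^ 2 * k ^ 2 * b ^ 5 + 8 * σ * p * k ^ 5 * A ^ 2 * b ^ 4 - 8 * σ * p * k ^ 5 * b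
    ^ 8 + 4 * σ * p * k ^ 3 * A * b ^ 4 - 12 * σ * p * k ^ 3 * b ^ 6 + 4 * σ * p * k * A * b ^ 2
    - 4 * σ * p * k * b ^ 4 - 2 * p ^ 2 * k ^ 8 * A ^ 3 * b ^ 5 - 6 * p ^ 2 * k ^ 8 * A ^ 2 * b
    ^ 7 - 6 * p ^ 2 * k ^ 8 * A * b ^ 9 - 2 * p ^ 2 * k ^ 8 * b ^ 11 - 2 * p ^ 2 * k ^ 6 * A ^ 2
    * b ^ 5 - 20 * p ^ 2 * k ^ 6 * A * b ^ 7 - 18 * p ^ 2 * k ^ 6 * b ^ 9 - p ^ 2 * k ^ 4 * A ^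
    2 * b ^ 3 - 6 * p ^ 2 * k ^ 4 * A * b ^ 5 - 21 * p ^ 2 * k ^ 4 * b ^ 7 - 8 * p ^ 2 * k ^ 2 *
    b ^ 5 - 2 * p * v * k ^ 8 * A ^ 3 * b ^ 4 - 6 * p * v * k ^ 8 * A ^ 2 * b ^ 6 - 6 * p * v *
    k ^ 8 * A * b ^ 8 - 2 * p * v * k ^ 8 * b ^ 10 - 2 * p * v * k ^ 6 * A ^ 2 * b ^ 4 - 20 * p
    * v * k ^ 6 * A * b ^ 6 - 18 * p * v * k ^ 6 * b ^ 8 + 4 * p * v * k ^ 4 * A * b ^ 4 - 12 *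
    p * v * k ^ 4 * b ^ 6 + k ^ 8 * A ^ 3 * b ^ 5 + 3 * k ^ 8 * A ^ 2 * b ^ 7 + 3 * k ^ 8 * A *
    b ^ 9 + k ^ 8 * b ^ 11) * hv

set_option maxHeartbeats 2000000 in
/-- The numerator of the third logarithmic derivative of `D`, corrected by the terms from the potential. -/
theorem logDeriv_numerator {c σ p v k A b : ℝ} (hc : c ^ 2 + A * σ ^ 2 = b ^ 2)
    (hv : v ^ 2 + b ^ 2 = b ^ 2 * p ^ 2)
    {F F₁ F₁₁ H H₂ H₁₁ g : ℝ}
    (hF : F = p + -k * c + k * b * σ) (hF₁ : F₁ = k * A * σ + k * b * c) (hF₁₁ : F₁₁ = k * A * c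
    - k * b * A * σ) (hH : H = σ + -(k * b) * p + -k * v) (hH₂ : H₂ = -(k * b) * v - k * b ^ 2 *
    p) (hH₁₁ : H₁₁ = -A * σ) (hg : g = 1 + k ^ 2 * (A + b ^ 2))
    {D D₁ Dx D₁₁ D₁x D₁₁x P P₁ Q E : ℝ}
    (hD : D = F * F + g * (H * H)) (hD₁ : D₁ = 2 * (F * F₁ + g * (H * c))) (hDx : Dx = 2 * (F *
    F₁ + g * (H * c)) + 2 * (F * v + g * (H * H₂))) (hD₁₁ : D₁₁ = 2 * (F₁ * F₁ + F * F₁₁ + g *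
    (c * c + H * H₁₁))) (hD₁x : D₁x = 2 * (F₁ * F₁ + F * F₁₁ + g * (c * c + H * H₁₁)) + 2 * (F₁
    * v + g * (c * H₂))) (hD₁₁x : D₁₁x = 2 * (3 * (F₁ * F₁₁ + g * (c * H₁₁)) - A * (F * F₁ + g *
    (H * c))) + 2 * (v * F₁₁ + g * (H₂ * H₁₁))) (hP : P = F * c - H * F₁) (hP₁ : P₁ = F * H₁₁ -
    H * F₁₁) (hQ : Q = F * H₂ - H * v) (hE : E = F₁ * F₁ + F₁ * v + g * (c * c + c * H₂)) :
    (A + b ^ 2) * (D₁₁x * D - 2 * D₁ * D₁x - D₁₁ * Dx + 8 * D₁ * E - 8 * g * (P + Q) * P₁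
        - 2 * k * (A + b ^ 2) * (P₁ * D - P * D₁)) = 4 * g * profile A b k p v c σ := by
  unfold profile
  subst hF hF₁ hF₁₁ hH hH₂ hH₁₁ hg
  -- The same normal forms modulo `hc` and `hv`, now for the entries of the logarithmic derivative.
  replace hD : D = -2 * c * σ * k ^ 2 * b - 2 * c * p * k + 2 * σ ^ 2 * k ^ 2 * b ^ 2 + σ ^ 2 -
      2 * σ * p * k ^ 3 * A * b - 2 * σ * p * k ^ 3 * b ^ 3 - 2 * σ * v * k ^ 3 * A - 2 * σ * v * k
      ^ 3 * b ^ 2 - 2 * σ * v * k + 2 * p ^ 2 * k ^ 4 * A * b ^ 2 + 2 * p ^ 2 * k ^ 4 * b ^ 4 + 2 *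
      p ^ 2 * k ^ 2 * b ^ 2 + p ^ 2 + 2 * p * v * k ^ 4 * A * b + 2 * p * v * k ^ 4 * b ^ 3 + 2 * p
      * v * k ^ 2 * b - k ^ 4 * A * b ^ 2 - k ^ 4 * b ^ 4 := by
    rw [hD]
    linear_combination (k ^ 2) * hc + (k ^ 4 * A + k ^ 4 * b ^ 2 + k ^ 2) * hv
  replace hD₁ : D₁ = 4 * c * σ * k ^ 2 * b ^ 2 + 2 * c * σ - 2 * c * p * k ^ 3 * A * b - 2 * c *
      p * k ^ 3 * b ^ 3 - 2 * c * v * k ^ 3 * A - 2 * c * v * k ^ 3 * b ^ 2 - 2 * c * v * k + 4 * σ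
      ^ 2 * k ^ 2 * A * b + 2 * σ * p * k * A - 2 * k ^ 2 * b ^ 3 := by
    rw [hD₁]
    linear_combination (-2 * k ^ 2 * b) * hc
  replace hDx : Dx = 4 * c * σ * k ^ 2 * b ^ 2 + 2 * c * σ - 2 * c * p * k ^ 3 * A * b - 2 * c *
      p * k ^ 3 * b ^ 3 - 2 * c * v * k ^ 3 * A - 2 * c * v * k ^ 3 * b ^ 2 - 4 * c * v * k + 4 * σ
      ^ 2 * k ^ 2 * A * b - 2 * σ * p * k ^ 3 * A * b ^ 2 - 2 * σ * p * k ^ 3 * b ^ 4 + 2 * σ * p *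
      k * A - 2 * σ * p * k * b ^ 2 - 2 * σ * v * k ^ 3 * A * b - 2 * σ * v * k ^ 3 * b ^ 3 + 4 * p
      ^ 2 * k ^ 4 * A * b ^ 3 + 4 * p ^ 2 * k ^ 4 * b ^ 5 + 4 * p ^ 2 * k ^ 2 * b ^ 3 + 4 * p * v *
      k ^ 4 * A * b ^ 2 + 4 * p * v * k ^ 4 * b ^ 4 + 4 * p * v * k ^ 2 * b ^ 2 + 2 * p * v - 2 * k
      ^ 4 * A * b ^ 3 - 2 * k ^ 4 * b ^ 5 - 4 * k ^ 2 * b ^ 3 := by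
    rw [hDx]
    linear_combination (-2 * k ^ 2 * b) * hc + (2 * k ^ 4 * A * b + 2 * k ^ 4 * b ^ 3 + 2 * k ^
      2 * b) * hv
  replace hD₁₁ : D₁₁ = 8 * c * σ * k ^ 2 * A * b + 2 * c * p * k * A - 8 * σ ^ 2 * k ^ 2 * A * b
      ^ 2 - 4 * σ ^ 2 * A + 2 * σ * p * k ^ 3 * A ^ 2 * b + 2 * σ * p * k ^ 3 * A * b ^ 3 + 2 * σ *
      v * k ^ 3 * A ^ 2 + 2 * σ * v * k ^ 3 * A * b ^ 2 + 2 * σ * v * k * A + 4 * k ^ 2 * b ^ 4 + 2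
      * b ^ 2 := by
    rw [hD₁₁]
    linear_combination (4 * k ^ 2 * b ^ 2 + 2) * hc
  replace hD₁x : D₁x = 8 * c * σ * k ^ 2 * A * b - 2 * c * p * k ^ 3 * A * b ^ 2 - 2 * c * p * k
      ^ 3 * b ^ 4 + 2 * c * p * k * A - 2 * c * p * k * b ^ 2 - 2 * c * v * k ^ 3 * A * b - 2 * c *
      v * k ^ 3 * b ^ 3 - 8 * σ ^ 2 * k ^ 2 * A * b ^ 2 - 4 * σ ^ 2 * A + 2 * σ * p * k ^ 3 * A ^ 2
      * b + 2 * σ * p * k ^ 3 * A * b ^ 3 + 2 * σ * v * k ^ 3 * A ^ 2 + 2 * σ * v * k ^ 3 * A * b ^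
      2 + 4 * σ * v * k * A + 4 * k ^ 2 * b ^ 4 + 2 * b ^ 2 := by
    rw [hD₁x]
    linear_combination (4 * k ^ 2 * b ^ 2 + 2) * hc
  replace hD₁₁x : D₁₁x = -16 * c * σ * k ^ 2 * A * b ^ 2 - 8 * c * σ * A + 2 * c * p * k ^ 3 * A
      ^ 2 * b + 2 * c * p * k ^ 3 * A * b ^ 3 + 2 * c * v * k ^ 3 * A ^ 2 + 2 * c * v * k ^ 3 * A *
      b ^ 2 + 4 * c * v * k * A - 16 * σ ^ 2 * k ^ 2 * A ^ 2 * b + 2 * σ * p * k ^ 3 * A ^ 2 * b ^ 2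
      + 2 * σ * p * k ^ 3 * A * b ^ 4 - 2 * σ * p * k * A ^ 2 + 2 * σ * p * k * A * b ^ 2 + 2 * σ *
      v * k ^ 3 * A ^ 2 * b + 2 * σ * v * k ^ 3 * A * b ^ 3 + 8 * k ^ 2 * A * b ^ 3 := by
    rw [hD₁₁x]
    linear_combination (8 * k ^ 2 * A * b) * hc
  replace hP : P = c * p * k ^ 2 * b ^ 2 + c * p + c * v * k ^ 2 * b + σ * p * k ^ 2 * A * b + σ
      * v * k ^ 2 * A - k * b ^ 2 := by
    rw [hP]
    linear_combination (-k) * hc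
  replace hP₁ : P₁ = c * p * k ^ 2 * A * b + c * v * k ^ 2 * A - σ * p * k ^ 2 * A * b ^ 2 - σ *
      p * A - σ * v * k ^ 2 * A * b := by
    rw [hP₁]
    linear_combination
  replace hQ : Q = c * p * k ^ 2 * b ^ 2 + c * v * k ^ 2 * b - σ * p * k ^ 2 * b ^ 3 - σ * v * k
      ^ 2 * b ^ 2 - σ * v - k * b ^ 2 := by
    rw [hQ]
    linear_combination (k) * hv
  replace hE : E = 2 * c * σ * k ^ 2 * A * b - c * p * k ^ 3 * A * b ^ 2 - c * p * k ^ 3 * b ^ 4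
      - c * p * k * b ^ 2 - c * v * k ^ 3 * A * b - c * v * k ^ 3 * b ^ 3 - 2 * σ ^ 2 * k ^ 2 * A *
      b ^ 2 - σ ^ 2 * A + σ * v * k * A + k ^ 2 * A * b ^ 2 + 2 * k ^ 2 * b ^ 4 + b ^ 2 := by
    rw [hE]
    linear_combination (k ^ 2 * A + 2 * k ^ 2 * b ^ 2 + 1) * hc
  rw [hD, hD₁, hDx, hD₁₁, hD₁x, hD₁₁x, hP, hP₁, hQ, hE]
  linear_combination
    (16 * σ * p * k ^ 5 * A ^ 3 * b ^ 2 + 24 * σ * p * k ^ 5 * A ^ 2 * b ^ 4 - 8 * σ * p * k ^ 5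
    * b ^ 8 + 12 * σ * p * k ^ 3 * A ^ 2 * b ^ 2 - 12 * σ * p * k ^ 3 * b ^ 6 + 8 * σ * p * k *
    A ^ 2 + 4 * σ * p * k * A * b ^ 2 - 4 * σ * p * k * b ^ 4 + 16 * σ * v * k ^ 5 * A ^ 3 * b +
    24 * σ * v * k ^ 5 * A ^ 2 * b ^ 3 - 8 * σ * v * k ^ 5 * b ^ 7 + 20 * σ * v * k ^ 3 * A ^ 2
    * b + 16 * σ * v * k ^ 3 * A * b ^ 3 - 4 * σ * v * k ^ 3 * b ^ 5 - 12 * p ^ 2 * k ^ 6 * A ^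
    3 * b ^ 3 - 20 * p ^ 2 * k ^ 6 * A ^ 2 * b ^ 5 - 4 * p ^ 2 * k ^ 6 * A * b ^ 7 + 4 * p ^ 2 *
    k ^ 6 * b ^ 9 - 12 * p ^ 2 * k ^ 4 * A ^ 2 * b ^ 3 - 8 * p ^ 2 * k ^ 4 * A * b ^ 5 + 4 * p ^
    2 * k ^ 4 * b ^ 7 - 8 * p ^ 2 * k ^ 2 * A ^ 2 * b - 8 * p ^ 2 * k ^ 2 * A * b ^ 3 - 24 * p *
    v * k ^ 6 * A ^ 3 * b ^ 2 - 40 * p * v * k ^ 6 * A ^ 2 * b ^ 4 - 8 * p * v * k ^ 6 * A * b ^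
    6 + 8 * p * v * k ^ 6 * b ^ 8 - 24 * p * v * k ^ 4 * A ^ 2 * b ^ 2 - 16 * p * v * k ^ 4 * A
    * b ^ 4 + 8 * p * v * k ^ 4 * b ^ 6 - 4 * p * v * k ^ 2 * A ^ 2 + 4 * p * v * k ^ 2 * b ^ 4
    - 12 * v ^ 2 * k ^ 6 * A ^ 3 * b - 20 * v ^ 2 * k ^ 6 * A ^ 2 * b ^ 3 - 4 * v ^ 2 * k ^ 6 *
    A * b ^ 5 + 4 * v ^ 2 * k ^ 6 * b ^ 7 - 12 * v ^ 2 * k ^ 4 * A ^ 2 * b - 8 * v ^ 2 * k ^ 4 *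
    A * b ^ 3 + 4 * v ^ 2 * k ^ 4 * b ^ 5) * hc
    + (32 * c * σ * k ^ 6 * A ^ 3 * b ^ 2 + 64 * c * σ * k ^ 6 * A ^ 2 * b ^ 4 + 32 * c * σ * k
    ^ 6 * A * b ^ 6 + 8 * c * σ * k ^ 4 * A ^ 3 + 48 * c * σ * k ^ 4 * A ^ 2 * b ^ 2 + 40 * c *
    σ * k ^ 4 * A * b ^ 4 + 8 * c * σ * k ^ 2 * A ^ 2 + 8 * c * σ * k ^ 2 * A * b ^ 2 + 8 * c *
    p * k ^ 5 * A ^ 3 * b + 16 * c * p * k ^ 5 * A ^ 2 * b ^ 3 + 8 * c * p * k ^ 5 * A * b ^ 5 +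
    8 * c * p * k ^ 3 * A ^ 2 * b + 8 * c * p * k ^ 3 * A * b ^ 3 + 16 * σ ^ 2 * k ^ 6 * A ^ 4 *
    b + 16 * σ ^ 2 * k ^ 6 * A ^ 3 * b ^ 3 - 16 * σ ^ 2 * k ^ 6 * A ^ 2 * b ^ 5 - 16 * σ ^ 2 * k
    ^ 6 * A * b ^ 7 + 8 * σ ^ 2 * k ^ 4 * A ^ 3 * b - 16 * σ ^ 2 * k ^ 4 * A ^ 2 * b ^ 3 - 24 *
    σ ^ 2 * k ^ 4 * A * b ^ 5 - 8 * σ ^ 2 * k ^ 2 * A ^ 2 * b - 8 * σ ^ 2 * k ^ 2 * A * b ^ 3 -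
    8 * σ * p * k ^ 5 * A ^ 3 * b ^ 2 - 16 * σ * p * k ^ 5 * A ^ 2 * b ^ 4 - 8 * σ * p * k ^ 5 *
    A * b ^ 6 - 4 * σ * p * k ^ 3 * A ^ 3 - 16 * σ * p * k ^ 3 * A ^ 2 * b ^ 2 - 12 * σ * p * k
    ^ 3 * A * b ^ 4 - 4 * σ * p * k * A ^ 2 - 4 * σ * p * k * A * b ^ 2 - 12 * k ^ 6 * A ^ 3 * b
    ^ 3 - 20 * k ^ 6 * A ^ 2 * b ^ 5 - 4 * k ^ 6 * A * b ^ 7 + 4 * k ^ 6 * b ^ 9 - 12 * k ^ 4 *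
    A ^ 2 * b ^ 3 - 8 * k ^ 4 * A * b ^ 5 + 4 * k ^ 4 * b ^ 7) * hv

/-! ### The four elementary fields, scaled so that sine differentiates to cosine and cosh to sinh.
-/

/-- The field `β cos (α y₁)`. -/
noncomputable def cosField (α β : ℝ) : Field := fun t x x₁ _ => β * Real.cos (α * y₁ α β t x x₁)

/-- The field `β sin (α y₁) / α`. -/
noncomputable def sinField (α β : ℝ) : Field :=
  fun t x x₁ _ => β * Real.sin (α * y₁ α β t x x₁) / α

/-- The field `cosh (β y₂)`. -/
noncomputable def coshField (α β : ℝ) : Field := fun t x _ x₂ => Real.cosh (β * y₂ α β t x x₂)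

/-- The field `β sinh (β y₂)`. -/
noncomputable def sinhField (α β : ℝ) : Field :=
  fun t x _ x₂ => β * Real.sinh (β * y₂ α β t x x₂)

theorem hasShiftDeriv_of_y₁ (α β : ℝ) {u u' : ℝ → ℝ} (hu : ∀ s, HasDerivAt u (u' s) s) :
    HasShiftDeriv (fun t x x₁ _ => u (y₁ α β t x x₁)) (fun t x x₁ _ => u' (y₁ α β t x x₁)) 0 where
  left t x x₁ _ := by
    have h : HasDerivAt (fun s => y₁ α β t x s) 1 x₁ := (hasDerivAt_id x₁).const_add _
    exact ((hu _).comp x₁ h).congr_deriv (mul_one _)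
  right _ _ _ _ := hasDerivAt_const _ _
  space t x x₁ _ := by
    have h : HasDerivAt (fun s => y₁ α β t s x₁) 1 x :=
      ((hasDerivAt_id x).add_const _).add_const _
    exact ((hu _).comp x h).congr_deriv ((mul_one _).trans (add_zero _).symm)

theorem hasShiftDeriv_of_y₂ (α β : ℝ) {u u' : ℝ → ℝ} (hu : ∀ s, HasDerivAt u (u' s) s) :
    HasShiftDeriv (fun t x _ x₂ => u (y₂ α β t x x₂)) 0 (fun t x _ x₂ => u' (y₂ α β t x x₂)) where
  left _ _ _ _ := hasDerivAt_const _ _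
  right t x _ x₂ := by
    have h : HasDerivAt (fun s => y₂ α β t x s) 1 x₂ := (hasDerivAt_id x₂).const_add _
    exact ((hu _).comp x₂ h).congr_deriv (mul_one _)
  space t x _ x₂ := by
    have h : HasDerivAt (fun s => y₂ α β t s x₂) 1 x :=
      ((hasDerivAt_id x).add_const _).add_const _
    exact ((hu _).comp x h).congr_deriv ((mul_one _).trans (zero_add _).symm)

theorem neg_cst (a : ℝ) : -cst a = cst (-a) := rfl

theorem hasShiftDeriv_cosField {α β : ℝ} (hα : α ≠ 0) :
    HasShiftDeriv (cosField α β) (-cst (α ^ 2) * sinField α β) 0 := by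
  refine hasShiftDeriv_of_y₁ α β (u := fun s => β * Real.cos (α * s))
    (u' := fun s => -(α ^ 2) * (β * Real.sin (α * s) / α)) (fun s => ?_)
  refine ((((hasDerivAt_id s).const_mul α).cos).const_mul β).congr_deriv ?_
  simp only [id]
  field_simp

theorem hasShiftDeriv_sinField {α β : ℝ} (hα : α ≠ 0) :
    HasShiftDeriv (sinField α β) (cosField α β) 0 := by
  refine hasShiftDeriv_of_y₁ α β (u := fun s => β * Real.sin (α * s) / α)
    (u' := fun s => β * Real.cos (α * s)) (fun s => ?_)
  refine (((((hasDerivAt_id s).const_mul α).sin).const_mul β).div_const α).congr_deriv ?_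
  simp only [id]
  field_simp

theorem hasShiftDeriv_coshField (α β : ℝ) :
    HasShiftDeriv (coshField α β) 0 (sinhField α β) := by
  refine hasShiftDeriv_of_y₂ α β (u := fun s => Real.cosh (β * s))
    (u' := fun s => β * Real.sinh (β * s)) (fun s => ?_)
  refine (((hasDerivAt_id s).const_mul β).cosh).congr_deriv ?_
  simp only [id]
  ring

theorem hasShiftDeriv_sinhField (α β : ℝ) :
    HasShiftDeriv (sinhField α β) 0 (cst (β ^ 2) * coshField α β) := by
  refine hasShiftDeriv_of_y₂ α β (u := fun s => β * Real.sinh (β * s))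
    (u' := fun s => β ^ 2 * Real.cosh (β * s)) (fun s => ?_)
  refine ((((hasDerivAt_id s).const_mul β).sinh).const_mul β).congr_deriv ?_
  simp only [id]
  ring

theorem isJet_cosField {α β : ℝ} (hα : α ≠ 0) :
    IsJet (α ^ 2) β (cosField α β) (-cst (α ^ 2) * sinField α β) 0
      (-cst (α ^ 2) * cosField α β) 0 where
  h := hasShiftDeriv_cosField hα
  h₁ := by
    rw [neg_cst]; simpa only [mul_zero] using (hasShiftDeriv_sinField hα).const_mul (-(α ^ 2))
  h₂ := .zero
  h₁₁ := by
    rw [neg_cst]; simpa only [mul_zero, neg_cst] using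
      (hasShiftDeriv_cosField hα).const_mul (-(α ^ 2))
  h₂₂ := by simpa using HasShiftDeriv.zero

theorem isJet_sinField {α β : ℝ} (hα : α ≠ 0) :
    IsJet (α ^ 2) β (sinField α β) (cosField α β) 0 (-cst (α ^ 2) * sinField α β) 0 where
  h := hasShiftDeriv_sinField hα
  h₁ := hasShiftDeriv_cosField hα
  h₂ := .zero
  h₁₁ := (isJet_cosField hα).h₁
  h₂₂ := by simpa using HasShiftDeriv.zero

/-- The `x₁`-derivatives vanish, so `A` is free; taking `A = α²` allows addition to the
trigonometric jets. -/
theorem isJet_coshField (α β A : ℝ) :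
    IsJet A β (coshField α β) 0 (sinhField α β) 0 (cst (β ^ 2) * coshField α β) where
  h := hasShiftDeriv_coshField α β
  h₁ := .zero
  h₂ := hasShiftDeriv_sinhField α β
  h₁₁ := by simpa using HasShiftDeriv.zero
  h₂₂ := by simpa using (hasShiftDeriv_coshField α β).const_mul (β ^ 2)

theorem isJet_sinhField (α β A : ℝ) :
    IsJet A β (sinhField α β) 0 (cst (β ^ 2) * coshField α β) 0
      (cst (β ^ 2) * sinhField α β) where
  h := hasShiftDeriv_sinhField α β
  h₁ := .zero
  h₂ := by simpa using (hasShiftDeriv_coshField α β).const_mul (β ^ 2)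
  h₁₁ := by simpa using HasShiftDeriv.zero
  h₂₂ := by simpa using (hasShiftDeriv_sinhField α β).const_mul (β ^ 2)

/-! ### The parameters `k = amp`, `Γ = ratio` and the decomposition of `F` and `G`. -/

/-- The amplitude `√2 μ / (√(α² + β²) √Δ)`. -/
noncomputable def amp (α β μ : ℝ) : ℝ := √2 * μ / (√(α ^ 2 + β ^ 2) * √(Delta α β μ))

/-- The ratio `√(α² + β²) / √Δ`. -/
noncomputable def ratio (α β μ : ℝ) : ℝ := √(α ^ 2 + β ^ 2) / √(Delta α β μ)

/-- The field `G / ratio`. -/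
noncomputable def reducedG (α β μ : ℝ) : Field :=
  sinField α β + cst (-(amp α β μ * β)) * coshField α β + cst (-amp α β μ) * sinhField α β

/-- The assembly of the second form of the determinant out of its numerators. -/
theorem second_form_of_numerators {S μ k Γ D D₁ Dx D₁₁ D₁x D₁₁x P P₁ Q E q : ℝ} (hD : D ≠ 0)
    (hm : √2 * Γ * μ = k * S) (hE : D₁ * Dx + 4 * Γ ^ 2 * (P * (P + Q)) = 4 * D * E)
    (hN : S * (D₁₁x * D - 2 * D₁ * D₁x - D₁₁ * Dx + 8 * D₁ * E - 8 * Γ ^ 2 * (P + Q) * P₁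
        - 2 * k * S * (P₁ * D - P * D₁)) = 4 * Γ ^ 2 * q) :
    2 * S * (-(μ + 2 * √2 * Γ * ((P + Q) / D)) * (2 * √2 * Γ * ((P₁ * D - P * D₁) / D ^ 2))
        + (D₁₁x * D ^ 2 - 2 * D₁ * D₁x * D - D₁₁ * Dx * D + 2 * D₁ ^ 2 * Dx) / D ^ 3)
      = 8 * Γ ^ 2 * q / D ^ 2 := by
  have h2 : √(2 : ℝ) ^ 2 = 2 := Real.sq_sqrt zero_le_two
  have h : 2 * S * (-(μ * D + 2 * √2 * Γ * (P + Q)) * (2 * √2 * Γ * (P₁ * D - P * D₁))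
      + (D₁₁x * D ^ 2 - 2 * D₁ * D₁x * D - D₁₁ * Dx * D + 2 * D₁ ^ 2 * Dx))
      = 8 * Γ ^ 2 * q * D := by
    -- `hE` merges `2 D₁² Dₓ` with `8 Γ² (P + Q) P D₁` into `8 D D₁ E`, which frees a factor `D`;
    -- `hm` rewrites the term in `μ`, and `h2` evaluates `(2√2)²`.
    linear_combination 2 * D * hN + 4 * S * D₁ * hE - 4 * S * D * (P₁ * D - P * D₁) * hm
      - 8 * S * Γ ^ 2 * (P + Q) * (P₁ * D - P * D₁) * h2
  rw [eq_div_iff (pow_ne_zero 2 hD), ← mul_left_inj' hD, ← h]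
  field_simp

section Parameters

variable {α β μ : ℝ}

theorem F_eq (hα : α ≠ 0) (hΔ : 0 < Delta α β μ) :
    F α β μ = coshField α β + cst (-amp α β μ) * cosField α β
      + cst (amp α β μ * β) * sinField α β := by
  have hr : √(Delta α β μ) ≠ 0 := (Real.sqrt_pos.2 hΔ).ne'
  have hs : √(α ^ 2 + β ^ 2) ≠ 0 := (Real.sqrt_pos.2 (by positivity)).ne'
  funext t x x₁ x₂
  simp only [F, coshField, cst, cosField, sinField, amp, Pi.add_apply, Pi.mul_apply]
  field_simp
  ring

theorem G_eq (hα : α ≠ 0) (hΔ : 0 < Delta α β μ) :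
    G α β μ = cst (ratio α β μ) * reducedG α β μ := by
  have hr : √(Delta α β μ) ≠ 0 := (Real.sqrt_pos.2 hΔ).ne'
  have hs : √(α ^ 2 + β ^ 2) ≠ 0 := (Real.sqrt_pos.2 (by positivity)).ne'
  funext t x x₁ x₂
  simp only [G, reducedG, coshField, cst, sinhField, sinField, amp, ratio, Pi.add_apply,
    Pi.mul_apply]
  -- The rewriting also hits `Δ` under the roots; `Real.sqrt_sq` restores those, so that only `√Δ`
  -- is left.
  rw [show Delta α β μ = √(Delta α β μ) ^ 2 from (Real.sq_sqrt hΔ.le).symm, Real.sqrt_sq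
    (Real.sqrt_nonneg _)]
  field_simp
  ring

theorem amp_sq (hΔ : 0 < Delta α β μ) :
    amp α β μ ^ 2 = 2 * μ ^ 2 / ((α ^ 2 + β ^ 2) * Delta α β μ) := by
  rw [amp, div_pow, mul_pow, mul_pow, Real.sq_sqrt hΔ.le, Real.sq_sqrt zero_le_two,
    Real.sq_sqrt (add_nonneg (sq_nonneg α) (sq_nonneg β))]

theorem ratio_sq_eq_div (hΔ : 0 < Delta α β μ) :
    ratio α β μ ^ 2 = (α ^ 2 + β ^ 2) / Delta α β μ := by
  rw [ratio, div_pow, Real.sq_sqrt hΔ.le, Real.sq_sqrt (add_nonneg (sq_nonneg α) (sq_nonneg β))]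

/-- This is `Δ + 2 μ² = α² + β²` divided by `Δ`. It makes the algebra depend on `μ` through `k`
alone. -/
theorem ratio_sq (hα : α ≠ 0) (hΔ : 0 < Delta α β μ) :
    ratio α β μ ^ 2 = 1 + amp α β μ ^ 2 * (α ^ 2 + β ^ 2) := by
  have hs : α ^ 2 + β ^ 2 ≠ 0 := by positivity
  rw [ratio_sq_eq_div hΔ, amp_sq hΔ]
  have := hΔ.ne'
  field_simp
  unfold Delta
  ring

/-- It expresses the term `-μ ∂₁² B̃` of the second formula through `k`. -/
theorem sqrt_two_mul_ratio_mul (hα : α ≠ 0) (hΔ : 0 < Delta α β μ) :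
    √2 * ratio α β μ * μ = amp α β μ * (α ^ 2 + β ^ 2) := by
  have hr : √(Delta α β μ) ≠ 0 := (Real.sqrt_pos.2 hΔ).ne'
  have hs : √(α ^ 2 + β ^ 2) ≠ 0 := (Real.sqrt_pos.2 (by positivity)).ne'
  rw [show α ^ 2 + β ^ 2 = √(α ^ 2 + β ^ 2) ^ 2 from (Real.sq_sqrt (by positivity)).symm, amp, ratio,
    Real.sq_sqrt (by positivity)]
  field_simp
  rw [Real.sq_sqrt (by positivity)]

theorem D_eq (hα : α ≠ 0) (hΔ : 0 < Delta α β μ) :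
    D α β μ = F α β μ * F α β μ
      + cst (ratio α β μ ^ 2) * (reducedG α β μ * reducedG α β μ) := by
  funext t x x₁ x₂
  simp only [D, G_eq hα hΔ, cst, Pi.add_apply, Pi.mul_apply]
  ring

theorem hasShiftDeriv_Btilde (hα : α ≠ 0) (hβ : β ≠ 0) (hΔ : 0 < Delta α β μ)
    {F₁ F₂ H₁ H₂ : Field} (hF : HasShiftDeriv (F α β μ) F₁ F₂)
    (hH : HasShiftDeriv (reducedG α β μ) H₁ H₂) :
    HasShiftDeriv (Btilde α β μ)
      (cst (2 * √2 * ratio α β μ) * ((F α β μ * H₁ - reducedG α β μ * F₁) / D α β μ))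
      (cst (2 * √2 * ratio α β μ) * ((F α β μ * H₂ - reducedG α β μ * F₂) / D α β μ)) := by
  have hG := hH.const_mul (ratio α β μ)
  rw [← G_eq hα hΔ] at hG
  convert (hF.arg hG (mem_slitPlane hα hβ hΔ)).const_mul (2 * √2) using 1
  · funext t x x₁ x₂
    simp only [Btilde, G_eq hα hΔ, cst, Pi.mul_apply]
  all_goals
    funext t x x₁ x₂
    simp only [G_eq hα hΔ, D, cst, Pi.add_apply, Pi.mul_apply, Pi.sub_apply, Pi.div_apply,
      Pi.pow_apply]
    ring

/-- The quadratic form `profile` in terms of double angles. -/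
theorem profile_eq (hα : α ≠ 0) (hβ : β ≠ 0) (hΔ : 0 < Delta α β μ) (a b : ℝ) :
    8 * ratio α β μ ^ 2 * profile (α ^ 2) β (amp α β μ) (Real.cosh (β * b))
        (β * Real.sinh (β * b)) (β * Real.cos (α * a)) (β * Real.sin (α * a) / α)
      = -(4 * β ^ 3 * (α ^ 2 + β ^ 2) ^ 2 * K α β μ / Delta α β μ ^ 3)
        * (Real.sinh (2 * β * b)
          + 4 * β ^ 2 * μ ^ 2 * Real.cosh (2 * β * b) / K α β μ
          - β * Delta α β μ * ((α ^ 2 + β ^ 2) ^ 2 - 2 * μ ^ 2 * (α ^ 2 - β ^ 2))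
              * Real.sin (2 * α * a) / (α * (α ^ 2 + β ^ 2) * K α β μ)
          + 4 * β ^ 2 * μ ^ 2 * Delta α β μ * Real.cos (2 * α * a)
              / ((α ^ 2 + β ^ 2) * K α β μ)) := by
  have hK := (K_pos hΔ).ne'
  have hs : α ^ 2 + β ^ 2 ≠ 0 := by positivity
  have hD := hΔ.ne'
  -- Once `sinh²` and `cos²` are eliminated, the two sides match coefficient by coefficient, so the
  -- four functions may become free variables.
  rw [mul_assoc 2 β b, mul_assoc 2 α a, Real.sinh_two_mul, Real.cosh_two_mul, Real.sin_two_mul,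
    Real.cos_two_mul, Real.sinh_sq, Real.cos_sq', profile, amp_sq hΔ, ratio_sq_eq_div hΔ]
  generalize Real.sinh (β * b) = v
  generalize Real.cosh (β * b) = p
  generalize Real.sin (α * a) = s
  generalize Real.cos (α * a) = c
  -- `K` and `Δ` stay atoms while denominators are cleared, and are expanded only afterwards.
  have e : K α β μ = Delta α β μ ^ 2 + 4 * μ ^ 2 * β ^ 2 := by unfold K Delta; ring
  have e' : Delta α β μ = α ^ 2 + β ^ 2 - 2 * μ ^ 2 := rfl
  generalize K α β μ = k at *
  generalize Delta α β μ = d at *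
  field_simp
  subst e
  subst e'
  ring

theorem breather_eq (hα : α ≠ 0) (hβ : β ≠ 0) (hΔ : 0 < Delta α β μ)
    {F₁ F₂ H₁ H₂ : Field} (hF : HasShiftDeriv (F α β μ) F₁ F₂)
    (hH : HasShiftDeriv (reducedG α β μ) H₁ H₂) :
    breather α β μ = cst (2 * √2 * ratio α β μ) *
      ((F α β μ * H₁ - reducedG α β μ * F₁ + (F α β μ * H₂ - reducedG α β μ * F₂))
        / D α β μ) := by
  rw [breather, (hasShiftDeriv_Btilde hα hβ hΔ hF hH).dx_eq]
  funext t x x₁ x₂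
  simp only [Pi.add_apply, Pi.mul_apply, Pi.div_apply]
  ring

theorem isJet_F (hα : α ≠ 0) (hΔ : 0 < Delta α β μ) :
    IsJet (α ^ 2) β (F α β μ)
      (0 + cst (-amp α β μ) * (-cst (α ^ 2) * sinField α β)
        + cst (amp α β μ * β) * cosField α β)
      (sinhField α β + cst (-amp α β μ) * 0 + cst (amp α β μ * β) * 0)
      (0 + cst (-amp α β μ) * (-cst (α ^ 2) * cosField α β)
        + cst (amp α β μ * β) * (-cst (α ^ 2) * sinField α β))
      (cst (β ^ 2) * coshField α β + cst (-amp α β μ) * 0 + cst (amp α β μ * β) * 0) := by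
  rw [F_eq hα hΔ]
  exact ((isJet_coshField α β (α ^ 2)).add ((isJet_cosField hα).const_mul (-amp α β μ))).add
    ((isJet_sinField hα).const_mul (amp α β μ * β))

theorem isJet_reducedG (μ : ℝ) (hα : α ≠ 0) :
    IsJet (α ^ 2) β (reducedG α β μ)
      (cosField α β + cst (-(amp α β μ * β)) * 0 + cst (-amp α β μ) * 0)
      (0 + cst (-(amp α β μ * β)) * sinhField α β
        + cst (-amp α β μ) * (cst (β ^ 2) * coshField α β))
      (-cst (α ^ 2) * sinField α β + cst (-(amp α β μ * β)) * 0 + cst (-amp α β μ) * 0)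
      (0 + cst (-(amp α β μ * β)) * (cst (β ^ 2) * coshField α β)
        + cst (-amp α β μ) * (cst (β ^ 2) * sinhField α β)) :=
  ((isJet_sinField hα).add ((isJet_coshField α β (α ^ 2)).const_mul (-(amp α β μ * β)))).add
    ((isJet_sinhField α β (α ^ 2)).const_mul (-amp α β μ))

/-! ### Both expressions equal `8 Γ² profile / D²`. -/

variable {F₁ F₂ F₁₁ F₂₂ H₁ H₂ H₁₁ H₂₂ : Field} {t x x₁ x₂ p v c σ : ℝ}

theorem det_wronskian_eq_profile (hα : α ≠ 0) (hβ : β ≠ 0) (hΔ : 0 < Delta α β μ)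
    (hF : IsJet (α ^ 2) β (F α β μ) F₁ F₂ F₁₁ F₂₂)
    (hH : IsJet (α ^ 2) β (reducedG α β μ) H₁ H₂ H₁₁ H₂₂)
    (hc : c ^ 2 + α ^ 2 * σ ^ 2 = β ^ 2) (hv : v ^ 2 + β ^ 2 = β ^ 2 * p ^ 2)
    (eF : F α β μ t x x₁ x₂ = p + -amp α β μ * c + amp α β μ * β * σ)
    (eF₁ : F₁ t x x₁ x₂ = amp α β μ * α ^ 2 * σ + amp α β μ * β * c)
    (eF₂ : F₂ t x x₁ x₂ = v)
    (eF₁₁ : F₁₁ t x x₁ x₂ = amp α β μ * α ^ 2 * c - amp α β μ * β * α ^ 2 * σ)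
    (eF₂₂ : F₂₂ t x x₁ x₂ = β ^ 2 * p)
    (eH : reducedG α β μ t x x₁ x₂ = σ + -(amp α β μ * β) * p + -amp α β μ * v)
    (eH₁ : H₁ t x x₁ x₂ = c)
    (eH₂ : H₂ t x x₁ x₂ = -(amp α β μ * β) * v - amp α β μ * β ^ 2 * p)
    (eH₁₁ : H₁₁ t x x₁ x₂ = -α ^ 2 * σ)
    (eH₂₂ : H₂₂ t x x₁ x₂ = -(amp α β μ * β ^ 3) * p - amp α β μ * β ^ 2 * v) :
    (wronskian (B₁ α β μ) (B₂ α β μ) t x x₁ x₂).det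
      = 8 * ratio α β μ ^ 2 * profile (α ^ 2) β (amp α β μ) p v c σ / D α β μ t x x₁ x₂ ^ 2 := by
  have hD0 : ∀ t x x₁ x₂, D α β μ t x x₁ x₂ ≠ 0 := fun t x x₁ x₂ => (D_pos hα hβ hΔ t x x₁ x₂).ne'
  have hDe := D_eq hα hΔ
  have hD := hF.quad (g := ratio α β μ ^ 2) hH
  rw [← hDe] at hD
  -- The closedness condition, proved by `ring`, is a polynomial identity in `F`, `H` and their
  -- first derivatives.
  refine (det_wronskian_of_potential _ (hF.alt₁ hH) (hF.alt₁' hH) (hF.alt₂ hH) (hF.alt₂' hH)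
    hD ((hF.quad₁ hH).add (hF.quad₂ hH)) hD0 (by rw [hDe, show (cst 2 : Field) = 2 from rfl]; ring)
    (breather_eq hα hβ hΔ hF.h hH.h) t x x₁ x₂).trans ?_
  rw [det_wronskian_numerators hc hv eF eF₁ eF₁₁ eF₂₂ eH eH₂ eH₁₁ eH₂₂ (ratio_sq hα hΔ)
    (D := D α β μ t x x₁ x₂)]
  · have := hD0 t x x₁ x₂
    have h2 : √(2 : ℝ) ^ 2 = 2 := Real.sq_sqrt zero_le_two
    rw [mul_pow, mul_pow, h2]
    field_simp
    ring
  · rw [hDe]; rfl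
  all_goals
    simp only [cst, Pi.add_apply, Pi.mul_apply, Pi.sub_apply, eF₂, eH₁]
    try ring

theorem second_form_eq_profile (hα : α ≠ 0) (hβ : β ≠ 0) (hΔ : 0 < Delta α β μ)
    (hF : IsJet (α ^ 2) β (F α β μ) F₁ F₂ F₁₁ F₂₂)
    (hH : IsJet (α ^ 2) β (reducedG α β μ) H₁ H₂ H₁₁ H₂₂)
    (hc : c ^ 2 + α ^ 2 * σ ^ 2 = β ^ 2) (hv : v ^ 2 + β ^ 2 = β ^ 2 * p ^ 2)
    (eF : F α β μ t x x₁ x₂ = p + -amp α β μ * c + amp α β μ * β * σ)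
    (eF₁ : F₁ t x x₁ x₂ = amp α β μ * α ^ 2 * σ + amp α β μ * β * c)
    (eF₂ : F₂ t x x₁ x₂ = v)
    (eF₁₁ : F₁₁ t x x₁ x₂ = amp α β μ * α ^ 2 * c - amp α β μ * β * α ^ 2 * σ)
    (eH : reducedG α β μ t x x₁ x₂ = σ + -(amp α β μ * β) * p + -amp α β μ * v)
    (eH₁ : H₁ t x x₁ x₂ = c)
    (eH₂ : H₂ t x x₁ x₂ = -(amp α β μ * β) * v - amp α β μ * β ^ 2 * p)
    (eH₁₁ : H₁₁ t x x₁ x₂ = -α ^ 2 * σ) :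
    2 * (α ^ 2 + β ^ 2) * (-(μ + breather α β μ t x x₁ x₂) * d₁ (d₁ (Btilde α β μ)) t x x₁ x₂
        + d₁ (d₁ (dx (fun t x x₁ x₂ => Real.log (D α β μ t x x₁ x₂)))) t x x₁ x₂)
      = 8 * ratio α β μ ^ 2 * profile (α ^ 2) β (amp α β μ) p v c σ / D α β μ t x x₁ x₂ ^ 2 := by
  have hD0 : ∀ t x x₁ x₂, D α β μ t x x₁ x₂ ≠ 0 := fun t x x₁ x₂ => (D_pos hα hβ hΔ t x x₁ x₂).ne'
  have hDe := D_eq hα hΔ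
  have hD := hF.quad (g := ratio α β μ ^ 2) hH
  rw [← hDe] at hD
  rw [d₁_d₁_dx_log hD (hF.quad₁ hH) ((hF.quad₁ hH).add (hF.quad₂ hH))
    ((hF.quad₁₁ hH).add (hF.quad₁₂ hH)) hD0, breather_eq hα hβ hΔ hF.h hH.h,
    (hasShiftDeriv_Btilde hα hβ hΔ hF.h hH.h).d₁_eq,
    (((hF.alt₁ hH).div hD hD0).const_mul _).d₁_eq]
  have hN := logDeriv_numerator hc hv eF eF₁ eF₁₁ eH eH₂ eH₁₁ (ratio_sq hα hΔ)
    (D := D α β μ t x x₁ x₂) (by rw [hDe]; rfl) rfl rfl rfl rfl rfl rfl rfl rfl rfl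
  have hDv : D α β μ t x x₁ x₂ = F α β μ t x x₁ x₂ * F α β μ t x x₁ x₂ + ratio α β μ ^ 2 *
    (reducedG α β μ t x x₁ x₂ * reducedG α β μ t x x₁ x₂) := by rw [hDe]; rfl
  refine second_form_of_numerators (E := F₁ t x x₁ x₂ * F₁ t x x₁ x₂ + F₁ t x x₁ x₂ * v
    + ratio α β μ ^ 2 * (c * c + c * H₂ t x x₁ x₂)) (hD0 t x x₁ x₂)
    (sqrt_two_mul_ratio_mul hα hΔ) ?_ ?_
  -- Lagrange's identity for the form `F² + Γ² H²` and the vectors of `∂₁`- and `∂ₓ`-derivatives of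
  -- `F`, `H`.
  · simp only [cst, Pi.add_apply, Pi.mul_apply, Pi.sub_apply, eF₂, eH₁, hDv]
    ring
  · simpa only [cst, Pi.add_apply, Pi.mul_apply, Pi.sub_apply, eF₂, eH₁] using hN

end Parameters

end Gardner

/-! ### Conclusion. -/

open Gardner in
theorem lemma5p7 (α β μ : ℝ) (hα : α ≠ 0) (hβ : β ≠ 0) (hμ : μ ≠ 0)
    (hΔ : 0 < Gardner.Delta α β μ) (t x x₁ x₂ : ℝ) :
    (Gardner.wronskian (Gardner.B₁ α β μ) (Gardner.B₂ α β μ) t x x₁ x₂).det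
      = -(4 * β ^ 3 * (α ^ 2 + β ^ 2) ^ 2 * Gardner.K α β μ
          / (Gardner.Delta α β μ ^ 3 * Gardner.D α β μ t x x₁ x₂ ^ 2))
        * (Real.sinh (2 * β * Gardner.y₂ α β t x x₂)
          + 4 * β ^ 2 * μ ^ 2 * Real.cosh (2 * β * Gardner.y₂ α β t x x₂) / Gardner.K α β μ
          - β * Gardner.Delta α β μ
              * ((α ^ 2 + β ^ 2) ^ 2 - 2 * μ ^ 2 * (α ^ 2 - β ^ 2))
              * Real.sin (2 * α * Gardner.y₁ α β t x x₁)
              / (α * (α ^ 2 + β ^ 2) * Gardner.K α β μ)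
          + 4 * β ^ 2 * μ ^ 2 * Gardner.Delta α β μ * Real.cos (2 * α * Gardner.y₁ α β t x x₁)
              / ((α ^ 2 + β ^ 2) * Gardner.K α β μ))
    ∧ (Gardner.wronskian (Gardner.B₁ α β μ) (Gardner.B₂ α β μ) t x x₁ x₂).det
      = 2 * (α ^ 2 + β ^ 2)
        * (-(μ + Gardner.breather α β μ t x x₁ x₂)
              * Gardner.d₁ (Gardner.d₁ (Gardner.Btilde α β μ)) t x x₁ x₂
          + Gardner.d₁ (Gardner.d₁ (Gardner.dx
              (fun t x x₁ x₂ => Real.log (Gardner.D α β μ t x x₁ x₂)))) t x x₁ x₂) := by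
  have hc : cosField α β t x x₁ x₂ ^ 2 + α ^ 2 * sinField α β t x x₁ x₂ ^ 2 = β ^ 2 := by
    simp only [cosField, sinField]
    field_simp
    exact Real.cos_sq_add_sin_sq _
  have hv : sinhField α β t x x₁ x₂ ^ 2 + β ^ 2 = β ^ 2 * coshField α β t x x₁ x₂ ^ 2 := by
    simp only [sinhField, coshField, Real.cosh_sq]
    ring
  have eF := congrFun (congrFun (congrFun (congrFun (F_eq (β := β) hα hΔ) t) x) x₁) x₂
  have hdet : (wronskian (B₁ α β μ) (B₂ α β μ) t x x₁ x₂).det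
      = 8 * ratio α β μ ^ 2 * profile (α ^ 2) β (amp α β μ) (coshField α β t x x₁ x₂)
          (sinhField α β t x x₁ x₂) (cosField α β t x x₁ x₂) (sinField α β t x x₁ x₂)
        / D α β μ t x x₁ x₂ ^ 2 := by
    refine det_wronskian_eq_profile hα hβ hΔ (isJet_F hα hΔ) (isJet_reducedG μ hα) hc hv eF
      ?_ ?_ ?_ ?_ rfl ?_ ?_ ?_ ?_
    all_goals
      simp [cst]
      try ring
  refine ⟨?_, hdet.trans (Eq.symm ?_)⟩
  · have h := profile_eq hα hβ hΔ (y₁ α β t x x₁) (y₂ α β t x x₂)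
    rw [hdet]
    simp only [coshField, sinhField, cosField, sinField]
    rw [h]
    ring
  · refine second_form_eq_profile hα hβ hΔ (isJet_F hα hΔ) (isJet_reducedG μ hα) hc hv
      eF ?_ ?_ ?_ rfl ?_ ?_ ?_
    all_goals
      simp [cst]
      try ring
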